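/- **Setting.** Let $\mathbb U$ be the set of finite words on $\{0,1\}$, $|u|$ the length of $u$, and for $u=u_1\cdots u_k$ let $I_u=\big(\sum_{j\le k}u_j2^{-j},\,2^{-k}+\sum_{j\le k}u_j2^{-j}\big)$. A complete binary tree is a finite set of words that contains the empty word, is closed under prefixes, and contains $u1$ if and only if it contains $u0$; its leaves are its words without proper extension in it. Let $(\mathcal T_n)_{n\ge 0}$ be the binary search tree process, i.e. the Markov chain of complete binary trees with $\mathcal T_0=\{\emptyset\}$ and $\mathcal T_{n+1}=\mathcal T_n\cup\{D_n0,D_n1\}$, where, given $\mathcal T_0,\dots,\mathcal T_n$, the word $D_n$ is uniform among the $n+1$ leaves of $\mathcal T_n$. Let $V$ be uniform on $[0,1]$ and independent of $(\mathcal T_n)_n$, let $\mathbf{Spine}_n$ be the (a.s. unique) leaf $u$ of $\mathcal T_n$ with $V\in I_u$, and let $s_n=|\mathbf{Spine}_n|$. Let ${}^d\mathbb P$ be the law of the marked tree process $(\mathcal T_n,\mathbf{Spine}_n)_{n\ge0}$ and let $\widehat{\mathcal F}_{(n)}=\sigma(\mathcal T_j,\mathbf{Spine}_j,\ j\le n)$.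 For $z>0$ put $$\mathcal E_n(z)=\frac{(2z)^{s_n}}{C_n(z)},\qquad C_n(z)=\prod_{k=0}^{n-1}\frac{k+2z}{k+1}.$$ **Proposition 5.1.** Let $z>0$. There is a unique probability measure ${}^d\mathbb P^{(2z)}$ on the space of trajectories of marked trees (the tilted law) such that, for every $n\ge0$, ${}^d\mathbb P^{(2z)}=\mathcal E_n(z)\,{}^d\mathbb P$ on $\widehat{\mathcal F}_{(n)}$. Under ${}^d\mathbb P^{(2z)}$: 1. (strong law) $\displaystyle \lim_{n\to\infty}\frac{s_n}{\log n}=2z$ almost surely; 2. (central limit theorem) $\displaystyle \frac{s_n-2z\log n}{\sqrt{2z\log n}}$ converges in distribution to $\mathcal N(0,1)$; 3. (large deviations) the distributions of $s_n/\log n$ satisfy the large deviation principle on $[0,\infty)$ with speed $\log n$ and rate function $\eta_{2z}(x)=x\log\frac{x}{2z}-x+2z$, $x\ge0$ (with $0\log0=0$): $\eta_{2z}$ is nonnegative and lower semicontinuous, and for every closed $F\subseteq[0,\infty)$ and every open $G\subseteq[0,\infty)$ (in the topology of $[0,\infty)$) $$\limsup_{n\to\infty}\frac{\log{}^d\mathbb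 P^{(2z)}(s_n/\log n\in F)}{\log n}\le-\inf_F\eta_{2z},\qquad \liminf_{n\to\infty}\frac{\log{}^d\mathbb P^{(2z)}(s_n/\log n\in G)}{\log n}\ge-\inf_G\eta_{2z}.$$ -/

import Mathlib

open MeasureTheory ProbabilityTheory Filter Topology
open scoped ENNReal NNReal

namespace BST

/-- A complete binary tree: a finite set of words over the alphabet `{0, 1}` (`false` is `0`, `true`
is `1`) that contains the empty word, is closed under prefixes, and contains `u0` iff it contains
`u1`. -/
@[ext]
structure BinTree where
  nodes : Finset (List Bool)
  root_mem : [] ∈ nodes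
  prefix_mem : ∀ u v : List Bool, u ++ v ∈ nodes → u ∈ nodes
  sibling_mem : ∀ u : List Bool, u ++ [true] ∈ nodes ↔ u ++ [false] ∈ nodes

/-- The leaves of a tree: the nodes without descendants in the tree (by prefix-closedness it is
enough to look at the two children). -/
def BinTree.leaves (t : BinTree) : Finset (List Bool) :=
  t.nodes.filter fun u => ∀ b : Bool, u ++ [b] ∉ t.nodes

/-- There are countably many trees; all sets of trees are measurable. -/
instance : MeasurableSpace BinTree := ⊤

instance : DiscreteMeasurableSpace BinTree := ⟨fun _ => trivial⟩

/-- The binary search tree process (in the random permutation model): the Markov chain of trees that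
starts from the tree reduced to its root and in which, given the past up to time `n`, the leaf `u`
that receives the two children `u0` and `u1` at time `n + 1` is uniform among the `n + 1` leaves. -/
structure IsBSTProcess {Ω : Type*} [MeasurableSpace Ω] (P : Measure Ω) (T : ℕ → Ω → BinTree) :
    Prop where
  measurable : ∀ n, Measurable (T n)
  initial : ∀ᵐ ω ∂P, (T 0 ω).nodes = {[]}
  step : ∀ (n : ℕ) (t : ℕ → BinTree), ∀ u ∈ (t n).leaves,
    P {ω | (∀ j ≤ n, T j ω = t j) ∧
        (T (n + 1) ω).nodes = (t n).nodes ∪ {u ++ [false], u ++ [true]}} =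
      ((n : ℝ≥0∞) + 1)⁻¹ * P {ω | ∀ j ≤ n, T j ω = t j}

/-- The left end `∑_{j = 1}^{k} u_j 2^{-j}` of the dyadic interval coded by `u = u_1 ⋯ u_k`. -/
noncomputable def leftEnd (u : List Bool) : ℝ :=
  ∑ j ∈ Finset.range u.length, if u.getD j false then (1 / 2 : ℝ) ^ (j + 1) else 0

/-- The dyadic interval `I_u` coded by the word `u`. -/
noncomputable def dyadicInterval (u : List Bool) : Set ℝ :=
  Set.Ioo (leftEnd u) (leftEnd u + (1 / 2 : ℝ) ^ u.length)

open Classical in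
/-- The leaf `u` of the tree `t` such that `v ∈ I_u`. The intervals of the leaves are disjoint and
cover `(0, 1)` up to finitely many dyadic points, so that this leaf is unique, and it exists for
almost every `v` in `[0, 1]`; the value `[]` otherwise is a convention. -/
noncomputable def spineLeaf (t : BinTree) (v : ℝ) : List Bool :=
  if h : ∃ u ∈ t.leaves, v ∈ dyadicInterval u then h.choose else []

/-- A tree together with a marked node. -/
@[ext]
structure MarkedTree where
  tree : BinTree
  spine : List Bool

instance : MeasurableSpace MarkedTree := ⊤

instance : DiscreteMeasurableSpace MarkedTree := ⟨fun _ => trivial⟩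

/-- Trajectories of marked trees, with the product σ-algebra, which is generated by the
trees and the spines at all times. -/
abbrev Path := ℕ → MarkedTree

/-- The spine depth `s_n`: the depth of the marked node at time `n`. -/
def depth (n : ℕ) (x : Path) : ℕ := (x n).spine.length

/-- The untilted law: the law of the marked tree process `(T_n, Spine_n)`, where `Spine_n` is the
leaf of `T_n` whose interval contains `V`. -/
noncomputable def untiltedLaw {Ω : Type*} [MeasurableSpace Ω] (P : Measure Ω)
    (T : ℕ → Ω → BinTree) (V : Ω → ℝ) : Measure Path :=
  P.map fun ω n => ⟨T n ω, spineLeaf (T n ω) (V ω)⟩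

/-- `C_n(z) = ∏_{k = 0}^{n - 1} (k + 2z) / (k + 1)`. -/
noncomputable def normConst (n : ℕ) (z : ℝ) : ℝ :=
  ∏ k ∈ Finset.range n, ((k : ℝ) + 2 * z) / ((k : ℝ) + 1)

/-- The exponential martingale `ℰ_n(z) = (2z)^{s_n} / C_n(z)`. -/
noncomputable def expMart (z : ℝ) (n : ℕ) (x : Path) : ℝ :=
  (2 * z) ^ depth n x / normConst n z

/-- `Q` is the tilt of `P₀`: on the σ-algebra generated by the trees and the spines up to time `n`,
it has density `ℰ_n(z)` with respect to `P₀`, for every `n`. -/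
def IsTiltedLaw (z : ℝ) (P₀ Q : Measure Path) : Prop :=
  ∀ (n : ℕ) (A : Set Path),
    MeasurableSet[Filtration.piLE (X := fun _ : ℕ => MarkedTree) n] A →
      Q A = ∫⁻ x in A, ENNReal.ofReal (expMart z n x) ∂P₀

/-- `η_λ(x) = x log (x / λ) - x + λ` for `x ≥ 0` (with `0 log 0 = 0`). -/
noncomputable def eta (l : ℝ) (x : ℝ≥0) : ℝ :=
  (x : ℝ) * Real.log ((x : ℝ) / l) - (x : ℝ) + l

/-- The large deviation principle for the measures `μ n`, with speed `a n → ∞` and rate function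
`I`: `I` is nonnegative and lower semicontinuous, and
`limsup (1 / a n) log μ n F ≤ - inf_F I` for closed `F`,
`liminf (1 / a n) log μ n G ≥ - inf_G I` for open `G`. -/
structure LargeDeviationPrinciple {E : Type*} [TopologicalSpace E] [MeasurableSpace E]
    (μ : ℕ → Measure E) (a : ℕ → ℝ) (I : E → EReal) : Prop where
  speed : Tendsto a atTop atTop
  rate_nonneg : ∀ x, 0 ≤ I x
  rate_lsc : LowerSemicontinuous I
  upper : ∀ F : Set E, IsClosed F →
    limsup (fun n => (((a n)⁻¹ : ℝ) : EReal) * ENNReal.log (μ n F)) atTop ≤ -(⨅ x ∈ F, I x)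
  lower : ∀ G : Set E, IsOpen G →
    -(⨅ x ∈ G, I x) ≤ liminf (fun n => (((a n)⁻¹ : ℝ) : EReal) * ENNReal.log (μ n G)) atTop

end BST

namespace BST

lemma leftEnd_nil : leftEnd [] = 0 := by simp [leftEnd]

lemma leftEnd_cons (b : Bool) (u : List Bool) :
    leftEnd (b :: u) = (if b then 1 / 2 else 0) + leftEnd u / 2 := by
  simp only [leftEnd, List.length_cons, Finset.sum_range_succ', Finset.sum_div, List.getD_cons_succ,
    List.getD_cons_zero]
  rw [add_comm]
  congr 1
  · simp
  · refine Finset.sum_congr rfl fun j _ => ?_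
    split_ifs <;> ring

lemma leftEnd_append_singleton (u : List Bool) (b : Bool) :
    leftEnd (u ++ [b]) = leftEnd u + if b then (1 / 2 : ℝ) ^ (u.length + 1) else 0 := by
  induction u with
  | nil => simp [leftEnd_cons, leftEnd_nil]
  | cons c u ih =>
    rw [List.cons_append, leftEnd_cons, leftEnd_cons, ih]
    simp only [List.length_cons]
    split_ifs <;> ring

lemma leftEnd_mem (u : List Bool) : 0 ≤ leftEnd u ∧ leftEnd u + (1 / 2 : ℝ) ^ u.length ≤ 1 := by
  induction u with
  | nil => simp [leftEnd_nil]
  | cons b u ih =>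
    rw [leftEnd_cons, List.length_cons, pow_succ]
    obtain ⟨h1, h2⟩ := ih
    split_ifs <;> constructor <;> linarith

lemma mem_dyadicInterval_cons {b : Bool} {u : List Bool} {v : ℝ}
    (h : v ∈ dyadicInterval (b :: u)) :
    2 * v - (if b then 1 else 0) ∈ dyadicInterval u ∧ (b = true ↔ 1 / 2 < v) := by
  obtain ⟨h1, h2⟩ := h
  rw [List.length_cons, pow_succ] at h2
  rw [leftEnd_cons] at h1 h2
  obtain ⟨h3, h4⟩ := leftEnd_mem u
  cases b
  · simp only [Bool.false_eq_true, if_false] at *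
    refine ⟨⟨by linarith, by linarith⟩, by simp only [false_iff, not_lt]; linarith⟩
  · simp only [if_true] at *
    refine ⟨⟨by linarith, by linarith⟩, by simp only [true_iff]; linarith⟩

/-- Two words whose dyadic intervals meet are comparable for the prefix order. -/
lemma prefix_or_prefix_of_mem {u w : List Bool} {v : ℝ} (hu : v ∈ dyadicInterval u)
    (hw : v ∈ dyadicInterval w) : u <+: w ∨ w <+: u := by
  induction u generalizing w v with
  | nil => exact Or.inl List.nil_prefix
  | cons b u ih =>
    cases w with
    | nil => exact Or.inr List.nil_prefix
    | cons c w =>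
      obtain ⟨hu1, hu2⟩ := mem_dyadicInterval_cons hu
      obtain ⟨hw1, hw2⟩ := mem_dyadicInterval_cons hw
      obtain rfl : b = c := by rw [Bool.eq_iff_iff, hu2, hw2]
      simpa [List.cons_prefix_cons] using ih hu1 hw1

lemma BinTree.mem_leaves {t : BinTree} {u : List Bool} :
    u ∈ t.leaves ↔ u ∈ t.nodes ∧ ∀ b : Bool, u ++ [b] ∉ t.nodes := by
  simp [BinTree.leaves]

lemma BinTree.eq_of_prefix {t : BinTree} {u w : List Bool} (hu : u ∈ t.leaves)
    (hw : w ∈ t.nodes) (h : u <+: w) : u = w := by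
  obtain ⟨r, rfl⟩ := h
  cases r with
  | nil => simp
  | cons b r =>
    exact absurd (t.prefix_mem (u ++ [b]) r (by simpa using hw)) ((mem_leaves.1 hu).2 b)

lemma leaf_unique {t : BinTree} {u w : List Bool} {v : ℝ} (hu : u ∈ t.leaves) (hw : w ∈ t.leaves)
    (huv : v ∈ dyadicInterval u) (hwv : v ∈ dyadicInterval w) : u = w := by
  rcases prefix_or_prefix_of_mem huv hwv with h | h
  · exact BinTree.eq_of_prefix hu (BinTree.mem_leaves.1 hw).1 h
  · exact (BinTree.eq_of_prefix hw (BinTree.mem_leaves.1 hu).1 h).symm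

lemma spineLeaf_eq {t : BinTree} {u : List Bool} {v : ℝ} (hu : u ∈ t.leaves)
    (huv : v ∈ dyadicInterval u) : spineLeaf t v = u := by
  have h : ∃ u ∈ t.leaves, v ∈ dyadicInterval u := ⟨u, hu, huv⟩
  rw [spineLeaf, dif_pos h]
  exact leaf_unique h.choose_spec.1 hu h.choose_spec.2 huv

/-- The midpoint of the dyadic interval coded by `u`. -/
noncomputable def midpoint (u : List Bool) : ℝ := leftEnd u + (1 / 2 : ℝ) ^ (u.length + 1)

/-- The points of `(0, 1)` that are not dyadic. -/
def nondyadic : Set ℝ := Set.Ioo 0 1 \ Set.range midpoint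

lemma exists_child {u : List Bool} {v : ℝ} (hv : v ∈ nondyadic) (h : v ∈ dyadicInterval u) :
    ∃ b : Bool, v ∈ dyadicInterval (u ++ [b]) := by
  obtain ⟨h1, h2⟩ := h
  have hm : v ≠ midpoint u := fun h => hv.2 ⟨u, h.symm⟩
  rw [midpoint] at hm
  have e : (1 / 2 : ℝ) ^ u.length = 2 * (1 / 2 : ℝ) ^ (u.length + 1) := by ring
  rw [e] at h2
  rcases lt_or_gt_of_ne hm with h | h
  · refine ⟨false, ?_, ?_⟩ <;> rw [leftEnd_append_singleton] <;> simp at * <;> linarith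
  · refine ⟨true, ?_, ?_⟩ <;> rw [leftEnd_append_singleton] <;> simp at * <;> linarith

lemma BinTree.append_mem_of_not_leaf {t : BinTree} {u : List Bool} (hu : u ∈ t.nodes)
    (h : u ∉ t.leaves) (b : Bool) : u ++ [b] ∈ t.nodes := by
  simp only [mem_leaves, hu, true_and, not_forall, not_not] at h
  obtain ⟨c, hc⟩ := h
  have := t.sibling_mem u
  cases b <;> cases c <;> tauto

lemma exists_leaf {v : ℝ} (hv : v ∈ nondyadic) (t : BinTree) :
    ∃ u ∈ t.leaves, v ∈ dyadicInterval u := by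
  classical
  have hne : (t.nodes.filter fun u => v ∈ dyadicInterval u).Nonempty := by
    refine ⟨[], Finset.mem_filter.2 ⟨t.root_mem, ?_⟩⟩
    simpa [dyadicInterval, leftEnd_nil] using hv.1
  obtain ⟨u, hu, hmax⟩ := Finset.exists_max_image _ List.length hne
  rw [Finset.mem_filter] at hu
  refine ⟨u, ?_, hu.2⟩
  by_contra hl
  obtain ⟨b, hb⟩ := exists_child hv hu.2
  have := hmax (u ++ [b]) (Finset.mem_filter.2 ⟨BinTree.append_mem_of_not_leaf hu.1 hl b, hb⟩)
  simp at this

lemma spineLeaf_spec {v : ℝ} (hv : v ∈ nondyadic) (t : BinTree) :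
    spineLeaf t v ∈ t.leaves ∧ v ∈ dyadicInterval (spineLeaf t v) := by
  obtain ⟨u, hu, huv⟩ := exists_leaf hv t
  rw [spineLeaf_eq hu huv]
  exact ⟨hu, huv⟩

instance : Countable BinTree :=
  Function.Injective.countable (f := BinTree.nodes) fun _ _ h => BinTree.ext h

instance : Countable MarkedTree :=
  Function.Injective.countable (f := fun m : MarkedTree => (m.tree, m.spine)) fun a b h => by
    simp only [Prod.mk.injEq] at h
    exact MarkedTree.ext h.1 h.2

instance : Nonempty BinTree := ⟨⟨{[]}, by simp, by simp, by simp⟩⟩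

instance : Nonempty MarkedTree := ⟨⟨Classical.arbitrary _, []⟩⟩

lemma measurableSet_spineLeaf_eq (t : BinTree) (u : List Bool) :
    MeasurableSet {v | spineLeaf t v = u} := by
  have hI : ∀ w, MeasurableSet (dyadicInterval w) := fun w => measurableSet_Ioo
  have hU : MeasurableSet (⋃ w ∈ t.leaves, dyadicInterval w) :=
    Finset.measurableSet_biUnion _ fun w _ => hI w
  have : {v | spineLeaf t v = u} = ({v | u ∈ t.leaves} ∩ dyadicInterval u) ∪
      ({v | [] = u} ∩ (⋃ w ∈ t.leaves, dyadicInterval w)ᶜ) := by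
    ext v
    simp only [Set.mem_ofPred_eq, Set.mem_union, Set.mem_inter_iff, Set.mem_compl_iff,
      Set.mem_iUnion, exists_prop]
    by_cases h : ∃ w ∈ t.leaves, v ∈ dyadicInterval w
    · obtain ⟨w, hw, hwv⟩ := h
      rw [spineLeaf_eq hw hwv]
      constructor
      · rintro rfl; exact Or.inl ⟨hw, hwv⟩
      · rintro (⟨h1, h2⟩ | ⟨_, h2⟩)
        · exact leaf_unique hw h1 hwv h2
        · exact absurd ⟨w, hw, hwv⟩ h2
    · rw [spineLeaf, dif_neg h]
      constructor
      · intro h'; exact Or.inr ⟨h', h⟩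
      · rintro (⟨h1, h2⟩ | ⟨h1, _⟩)
        · exact absurd ⟨u, h1, h2⟩ h
        · exact h1
  rw [this]
  exact ((MeasurableSet.const _).inter (hI u)).union ((MeasurableSet.const _).inter hU.compl)

/-- `t'` is obtained from `t` by giving two children to the leaf `u`. -/
def Grows (t : BinTree) (u : List Bool) (t' : BinTree) : Prop :=
  u ∈ t.leaves ∧ t'.nodes = t.nodes ∪ {u ++ [false], u ++ [true]}

lemma Grows.mem_nodes {t t' : BinTree} {u w : List Bool} (h : Grows t u t') :
    w ∈ t'.nodes ↔ w ∈ t.nodes ∨ ∃ b : Bool, w = u ++ [b] := by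
  rw [h.2]
  simp [or_comm, or_assoc]

lemma Grows.unique {t t' : BinTree} {u w : List Bool} (h : Grows t u t') (h' : Grows t w t') :
    u = w := by
  have h1 : u ++ [false] ∈ t'.nodes := h.mem_nodes.2 (Or.inr ⟨_, rfl⟩)
  rcases h'.mem_nodes.1 h1 with h2 | ⟨b, hb⟩
  · exact absurd h2 ((BinTree.mem_leaves.1 h.1).2 _)
  · exact (List.append_inj' hb rfl).1

lemma Grows.mem_leaves {t t' : BinTree} {u w : List Bool} (h : Grows t u t') :
    w ∈ t'.leaves ↔ (w ∈ t.leaves ∧ w ≠ u) ∨ ∃ b : Bool, w = u ++ [b] := by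
  have hu := BinTree.mem_leaves.1 h.1
  constructor
  · intro hw
    obtain ⟨h1, h2⟩ := BinTree.mem_leaves.1 hw
    rcases h.mem_nodes.1 h1 with h3 | h3
    · refine Or.inl ⟨BinTree.mem_leaves.2 ⟨h3, fun b hb => h2 b (h.mem_nodes.2 (Or.inl hb))⟩, ?_⟩
      rintro rfl
      exact h2 true (h.mem_nodes.2 (Or.inr ⟨_, rfl⟩))
    · exact Or.inr h3
  · rintro (⟨h1, h2⟩ | ⟨b, rfl⟩)
    · rw [BinTree.mem_leaves] at h1 ⊢
      refine ⟨h.mem_nodes.2 (Or.inl h1.1), fun b hb => ?_⟩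
      rcases h.mem_nodes.1 hb with h3 | ⟨c, hc⟩
      · exact h1.2 b h3
      · exact h2 (List.append_inj' hc rfl).1
    · rw [BinTree.mem_leaves]
      refine ⟨h.mem_nodes.2 (Or.inr ⟨_, rfl⟩), fun c hc => ?_⟩
      rcases h.mem_nodes.1 hc with h3 | ⟨d, hd⟩
      · exact hu.2 b (t.prefix_mem _ _ h3)
      · have := congrArg List.length hd
        simp at this

lemma Grows.card_leaves {t t' : BinTree} {u : List Bool} (h : Grows t u t') :
    t'.leaves.card = t.leaves.card + 1 := by
  have e : t'.leaves = insert (u ++ [false]) (insert (u ++ [true]) (t.leaves.erase u)) := by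
    ext w
    simp only [h.mem_leaves, Bool.exists_bool, Finset.mem_insert, Finset.mem_erase]
    tauto
  have hn : ∀ b : Bool, u ++ [b] ∉ t.leaves := fun b hb =>
    (BinTree.mem_leaves.1 h.1).2 b (BinTree.mem_leaves.1 hb).1
  have hpos : 0 < t.leaves.card := Finset.card_pos.2 ⟨u, h.1⟩
  rw [e, Finset.card_insert_of_notMem, Finset.card_insert_of_notMem, Finset.card_erase_of_mem h.1]
  · omega
  · simp [hn]
  · simp [hn]

/-- The depth of the spine goes up if and only if the growing leaf is the spine. -/
lemma Grows.length_spineLeaf {t t' : BinTree} {u : List Bool} (h : Grows t u t') {v : ℝ}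
    (hv : v ∈ nondyadic) :
    (spineLeaf t' v).length = (spineLeaf t v).length + if spineLeaf t v = u then 1 else 0 := by
  obtain ⟨h1, h2⟩ := spineLeaf_spec hv t
  split_ifs with hu
  · obtain ⟨b, hb⟩ := exists_child hv h2
    rw [spineLeaf_eq (h.mem_leaves.2 (Or.inr ⟨b, by rw [hu]⟩)) hb]
    simp
  · rw [spineLeaf_eq (h.mem_leaves.2 (Or.inl ⟨h1, hu⟩)) h2, add_zero]

lemma BinTree.leaves_of_nodes_eq {t : BinTree} (h : t.nodes = {[]}) : t.leaves = {[]} := by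
  ext u
  simp only [mem_leaves, h, Finset.mem_singleton]
  constructor
  · exact fun h => h.1
  · rintro rfl; simp

section SpineProcess

variable {Ω : Type*} [MeasurableSpace Ω] {P : Measure Ω}

/-- To check a property almost surely, it is enough to do it on each trajectory up to time `n`. -/
lemma ae_of_forall_path {S : Type*} [Countable S] {X : ℕ → Ω → S} (n : ℕ) {p : Ω → Prop}
    (h : ∀ x : ℕ → S, ∀ᵐ ω ∂P, (∀ j ≤ n, X j ω = x j) → p ω) : ∀ᵐ ω ∂P, p ω := by
  have key : ∀ᵐ ω ∂P, ∀ r : Fin (n + 1) → S, (∀ j ≤ n, X j ω = r (Fin.ofNat (n + 1) j)) → p ω :=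
    ae_all_iff.2 fun r => h fun j => r (Fin.ofNat (n + 1) j)
  filter_upwards [key] with ω hω
  refine hω (fun i => X i ω) fun j hj => ?_
  simp [Nat.mod_eq_of_lt (Nat.lt_succ_of_le hj)]

variable {T : ℕ → Ω → BinTree}

lemma IsBSTProcess.measurableSet_path (hT : IsBSTProcess P T) (n : ℕ) (t : ℕ → BinTree) :
    MeasurableSet {ω | ∀ j ≤ n, T j ω = t j} := by
  have : {ω | ∀ j ≤ n, T j ω = t j} = ⋂ j ∈ Finset.Iic n, T j ⁻¹' {t j} := by
    ext ω; simp
  rw [this]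
  exact Finset.measurableSet_biInter _ fun j _ => hT.measurable j (MeasurableSet.of_discrete)

lemma IsBSTProcess.measurableSet_step (hT : IsBSTProcess P T) (n : ℕ) (t : ℕ → BinTree)
    (N : Finset (List Bool)) :
    MeasurableSet {ω | (∀ j ≤ n, T j ω = t j) ∧ (T (n + 1) ω).nodes = N} :=
  (hT.measurableSet_path n t).inter (s₂ := T (n + 1) ⁻¹' {t | t.nodes = N})
    (hT.measurable (n + 1) MeasurableSet.of_discrete)

lemma IsBSTProcess.measure_exists_grows [IsFiniteMeasure P] (hT : IsBSTProcess P T) (n : ℕ)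
    (t : ℕ → BinTree) (ht : (t n).leaves.card = n + 1) :
    ∀ᵐ ω ∂P, (∀ j ≤ n, T j ω = t j) → ∃ u, Grows (T n ω) u (T (n + 1) ω) := by
  let A : List Bool → Set Ω := fun u => {ω | (∀ j ≤ n, T j ω = t j) ∧
        (T (n + 1) ω).nodes = (t n).nodes ∪ {u ++ [false], u ++ [true]}}
  have hA : ∀ u, MeasurableSet (A u) := fun u => hT.measurableSet_step n t _
  have hdisj : Set.PairwiseDisjoint (↑(t n).leaves) A := by
    intro u hu w hw huw
    refine Set.disjoint_left.2 fun ω h1 h2 => huw ?_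
    exact Grows.unique (t := t n) (t' := T (n + 1) ω) ⟨hu, h1.2⟩ ⟨hw, h2.2⟩
  have hm : P (⋃ u ∈ (t n).leaves, A u) = P {ω | ∀ j ≤ n, T j ω = t j} := by
    rw [measure_biUnion_finset hdisj fun u _ => hA u,
      Finset.sum_congr rfl fun u hu => hT.step n t u hu, Finset.sum_const, ht, nsmul_eq_mul,
      ← mul_assoc]
    push_cast
    rw [ENNReal.mul_inv_cancel (by positivity) (by finiteness), one_mul]
  have hae := ae_eq_of_subset_of_measure_ge (μ := P)
    (s := ⋃ u ∈ (t n).leaves, A u) (t := {ω | ∀ j ≤ n, T j ω = t j})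
    (Set.iUnion₂_subset fun u _ ω hω => hω.1) hm.ge
    (Finset.measurableSet_biUnion _ fun u _ => hA u).nullMeasurableSet (measure_ne_top _ _)
  filter_upwards [hae.mem_iff] with ω hω hp
  obtain ⟨u, hu, h⟩ := Set.mem_iUnion₂.1 (hω.2 hp)
  exact ⟨u, by rw [hp n le_rfl]; exact ⟨hu, h.2⟩⟩

theorem IsBSTProcess.ae_exists_grows [IsFiniteMeasure P] (hT : IsBSTProcess P T) :
    ∀ᵐ ω ∂P, ∀ n, ∃ u, Grows (T n ω) u (T (n + 1) ω) := by
  have key : ∀ n, (∀ᵐ ω ∂P, (T n ω).leaves.card = n + 1) ∧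
      ∀ᵐ ω ∂P, ∃ u, Grows (T n ω) u (T (n + 1) ω) := by
    intro n
    have hgrow : ∀ n, (∀ᵐ ω ∂P, (T n ω).leaves.card = n + 1) →
        ∀ᵐ ω ∂P, ∃ u, Grows (T n ω) u (T (n + 1) ω) := by
      intro n hc
      refine ae_of_forall_path (X := T) n fun t => ?_
      by_cases ht : (t n).leaves.card = n + 1
      · exact hT.measure_exists_grows n t ht
      · filter_upwards [hc] with ω hω hp
        exact absurd (hp n le_rfl ▸ hω) ht
    have hcard : ∀ᵐ ω ∂P, (T n ω).leaves.card = n + 1 := by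
      induction n with
      | zero =>
        filter_upwards [hT.initial] with ω hω
        simp [BinTree.leaves_of_nodes_eq hω]
      | succ n ih =>
        filter_upwards [ih, hgrow n ih] with ω h1 ⟨u, h2⟩
        rw [h2.card_leaves, h1]
    exact ⟨hcard, hgrow n hcard⟩
  exact ae_all_iff.2 fun n => (key n).2

/-- The trajectory of the marked tree process. -/
noncomputable def markedPath (T : ℕ → Ω → BinTree) (V : Ω → ℝ) (ω : Ω) : Path :=
  fun n => ⟨T n ω, spineLeaf (T n ω) (V ω)⟩

variable {V : Ω → ℝ}

lemma measurable_markedPath (hT : IsBSTProcess P T) (hV : Measurable V) :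
    Measurable (markedPath T V) := by
  refine measurable_pi_iff.2 fun n => measurable_to_countable' fun m => ?_
  have : (fun ω => markedPath T V ω n) ⁻¹' {m} =
      T n ⁻¹' {m.tree} ∩ V ⁻¹' {v | spineLeaf m.tree v = m.spine} := by
    ext ω
    simp only [markedPath, Set.mem_preimage, Set.mem_singleton_iff, Set.mem_inter_iff,
      MarkedTree.ext_iff, Set.mem_ofPred_eq]
    constructor
    · rintro ⟨h1, h2⟩; exact ⟨h1, h1 ▸ h2⟩
    · rintro ⟨h1, h2⟩; exact ⟨h1, h1 ▸ h2⟩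
  rw [this]
  exact (hT.measurable n MeasurableSet.of_discrete).inter (hV (measurableSet_spineLeaf_eq _ _))

lemma untiltedLaw_eq (P : Measure Ω) (T : ℕ → Ω → BinTree) (V : Ω → ℝ) :
    untiltedLaw P T V = P.map (markedPath T V) := rfl

lemma ae_nondyadic (hVunif : pdf.IsUniform V (Set.Icc 0 1) P volume) (hV : Measurable V) :
    ∀ᵐ ω ∂P, V ω ∈ nondyadic := by
  have h : ∀ᵐ v ∂P.map V, v ∈ nondyadic := by
    rw [hVunif, ProbabilityTheory.cond]
    refine Measure.ae_smul_measure ?_ _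
    have h0 : ∀ᵐ v : ℝ, v ∉ Set.range midpoint ∪ {0, 1} := by
      refine measure_eq_zero_iff_ae_notMem.1 ?_
      exact (((Set.countable_range _).union (Set.toFinite _).countable)).measure_zero _
    filter_upwards [ae_restrict_of_ae h0, ae_restrict_mem measurableSet_Icc] with v h1 h2
    simp only [Set.mem_union, Set.mem_insert_iff, Set.mem_singleton_iff, not_or] at h1
    exact ⟨⟨lt_of_le_of_ne h2.1 (Ne.symm h1.2.1), lt_of_le_of_ne h2.2 h1.2.2⟩, h1.1⟩
  exact ae_of_ae_map hV.aemeasurable h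

variable [IsProbabilityMeasure P]

/-- Given the past up to time `n`, the depth of the spine goes up with probability `1 / (n + 1)`. -/
theorem measure_depth_up (hT : IsBSTProcess P T) (hV : Measurable V)
    (hVunif : pdf.IsUniform V (Set.Icc 0 1) P volume)
    (hindep : IndepFun (fun ω n => T n ω) V P) (n : ℕ) (x : Path) :
    P {ω | (∀ j ≤ n, markedPath T V ω j = x j) ∧
      depth (n + 1) (markedPath T V ω) = depth n (markedPath T V ω) + 1} =
    ((n : ℝ≥0∞) + 1)⁻¹ * P {ω | ∀ j ≤ n, markedPath T V ω j = x j} := by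
  have hnd := ae_nondyadic hVunif hV
  by_cases hu : (x n).spine ∈ (x n).tree.leaves
  · let u := (x n).spine
    let t : ℕ → BinTree := fun j => (x j).tree
    let B : Set ℝ := ⋂ j ∈ Finset.Iic n, {v | spineLeaf (x j).tree v = (x j).spine}
    have hB : MeasurableSet B :=
      Finset.measurableSet_biInter _ fun j _ => measurableSet_spineLeaf_eq _ _
    have hpath : ∀ ω, (∀ j ≤ n, markedPath T V ω j = x j) ↔
        (∀ j ≤ n, T j ω = t j) ∧ V ω ∈ B := by
      intro ω
      simp only [markedPath, MarkedTree.ext_iff, B, t, Finset.mem_Iic, Set.mem_iInter,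
        Set.mem_ofPred_eq]
      constructor
      · intro h
        exact ⟨fun j hj => (h j hj).1, fun j hj => by rw [← (h j hj).1]; exact (h j hj).2⟩
      · rintro ⟨h1, h2⟩ j hj
        exact ⟨h1 j hj, by rw [h1 j hj]; exact h2 j hj⟩
    let C₀ : Set (ℕ → BinTree) := {s | ∀ j ≤ n, s j = t j}
    let C₁ : Set (ℕ → BinTree) :=
      {s | (∀ j ≤ n, s j = t j) ∧ (s (n + 1)).nodes = (t n).nodes ∪ {u ++ [false], u ++ [true]}}
    have hC₀ : MeasurableSet C₀ := by
      have : C₀ = ⋂ j ∈ Finset.Iic n, (fun s : ℕ → BinTree => s j) ⁻¹' {t j} := by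
        ext s; simp [C₀]
      rw [this]
      exact Finset.measurableSet_biInter _ fun j _ =>
        measurable_pi_apply j MeasurableSet.of_discrete
    have hC₁ : MeasurableSet C₁ := hC₀.inter (s₂ := (fun s : ℕ → BinTree => s (n + 1)) ⁻¹'
        {s | s.nodes = (t n).nodes ∪ {u ++ [false], u ++ [true]}})
      (measurable_pi_apply (n + 1) MeasurableSet.of_discrete)
    have e0 : {ω | ∀ j ≤ n, markedPath T V ω j = x j} =
        (fun ω n => T n ω) ⁻¹' C₀ ∩ V ⁻¹' B := by
      ext ω; exact hpath ω
    have e1 : {ω | (∀ j ≤ n, markedPath T V ω j = x j) ∧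
        depth (n + 1) (markedPath T V ω) = depth n (markedPath T V ω) + 1} =ᵐ[P]
        ((fun ω n => T n ω) ⁻¹' C₁ ∩ V ⁻¹' B : Set Ω) := by
      rw [eventuallyEq_set]
      filter_upwards [hnd, hT.ae_exists_grows] with ω h1 h2
      obtain ⟨w, hw⟩ := h2 n
      simp only [Set.mem_ofPred_eq, Set.mem_inter_iff, Set.mem_preimage, C₁, hpath]
      have hlen : depth (n + 1) (markedPath T V ω) = depth n (markedPath T V ω) +
        if spineLeaf (T n ω) (V ω) = w then 1 else 0 := hw.length_spineLeaf h1
      rw [hlen]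
      constructor
      · rintro ⟨⟨h3, h4⟩, h5⟩
        refine ⟨⟨h3, ?_⟩, h4⟩
        have h6 : spineLeaf (T n ω) (V ω) = u := by
          have := ((hpath ω).2 ⟨h3, h4⟩) n le_rfl
          simp [u, ← this, markedPath]
        split_ifs at h5 with h7
        · rw [hw.2, h3 n le_rfl, ← h7, h6]
        · omega
      · rintro ⟨⟨h3, h5⟩, h4⟩
        refine ⟨⟨h3, h4⟩, ?_⟩
        have h6 : spineLeaf (T n ω) (V ω) = u := by
          have := ((hpath ω).2 ⟨h3, h4⟩) n le_rfl
          simp [u, ← this, markedPath]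
        rw [h3 n le_rfl] at hw
        have h7 : u = w := Grows.unique (t := t n) ⟨hu, h5⟩ hw
        rw [if_pos (h6.trans h7)]
    rw [measure_congr e1, e0, hindep.measure_inter_preimage_eq_mul _ _ hC₁ hB,
      hindep.measure_inter_preimage_eq_mul _ _ hC₀ hB, ← mul_assoc]
    congr 1
    exact hT.step n t u hu
  · have h0 : P {ω | ∀ j ≤ n, markedPath T V ω j = x j} = 0 := by
      rw [measure_eq_zero_iff_ae_notMem]
      filter_upwards [hnd] with ω h1 h2
      refine hu ?_
      rw [← h2 n le_rfl]
      exact (spineLeaf_spec h1 _).1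
    rw [h0, mul_zero]
    exact measure_mono_null (fun ω h => h.1) h0

/-- The law of a marked tree process whose spine depth goes up by one at time `n + 1` with
probability `1 / (n + 1)`, independently of the past. -/
structure IsRecordLaw (P₀ : Measure Path) : Prop where
  depth_zero : ∀ᵐ x ∂P₀, depth 0 x = 0
  depth_succ : ∀ᵐ x ∂P₀, ∀ n, depth (n + 1) x = depth n x ∨ depth (n + 1) x = depth n x + 1
  up : ∀ (n : ℕ) (y : Path),
    P₀ {x | (∀ j ≤ n, x j = y j) ∧ depth (n + 1) x = depth n x + 1} =
      ((n : ℝ≥0∞) + 1)⁻¹ * P₀ {x | ∀ j ≤ n, x j = y j}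

lemma measurable_depth (n : ℕ) : Measurable (depth n) :=
  (Measurable.of_discrete (f := fun m : MarkedTree => m.spine.length)).comp (measurable_pi_apply n)

lemma measurableSet_forall_le_eq (n : ℕ) (y : Path) :
    MeasurableSet {x : Path | ∀ j ≤ n, x j = y j} := by
  have : {x : Path | ∀ j ≤ n, x j = y j} = ⋂ j ∈ Finset.Iic n, (fun s : Path => s j) ⁻¹' {y j} := by
    ext s; simp
  rw [this]
  exact Finset.measurableSet_biInter _ fun j _ => measurable_pi_apply j MeasurableSet.of_discrete

lemma measurableSet_depth_up (n : ℕ) : MeasurableSet {x | depth (n + 1) x = depth n x + 1} :=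
  measurableSet_eq_fun (measurable_depth _) ((measurable_depth n).add_const 1)

theorem isRecordLaw_untiltedLaw (hT : IsBSTProcess P T) (hV : Measurable V)
    (hVunif : pdf.IsUniform V (Set.Icc 0 1) P volume)
    (hindep : IndepFun (fun ω n => T n ω) V P) : IsRecordLaw (untiltedLaw P T V) := by
  have hm := measurable_markedPath hT hV
  have hnd := ae_nondyadic hVunif hV
  rw [untiltedLaw_eq]
  refine ⟨?_, ?_, fun n y => ?_⟩
  · rw [ae_map_iff hm.aemeasurable (measurableSet_eq_fun (measurable_depth 0) measurable_const)]
    filter_upwards [hnd, hT.initial] with ω h1 h2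
    have := (spineLeaf_spec h1 (T 0 ω)).1
    rw [BinTree.leaves_of_nodes_eq h2, Finset.mem_singleton] at this
    simp [depth, markedPath, this]
  · rw [ae_all_iff]
    intro n
    have hs : MeasurableSet {x | depth (n + 1) x = depth n x ∨ depth (n + 1) x = depth n x + 1} :=
      (measurableSet_eq_fun (measurable_depth _) (measurable_depth n)).union
        (measurableSet_depth_up n)
    rw [ae_map_iff hm.aemeasurable hs]
    filter_upwards [hnd, hT.ae_exists_grows] with ω h1 h2
    obtain ⟨w, hw⟩ := h2 n
    have hlen : depth (n + 1) (markedPath T V ω) = depth n (markedPath T V ω) +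
        if spineLeaf (T n ω) (V ω) = w then 1 else 0 := hw.length_spineLeaf h1
    split_ifs at hlen with h
    · exact Or.inr hlen
    · exact Or.inl hlen
  · have hs : MeasurableSet {x | (∀ j ≤ n, x j = y j) ∧ depth (n + 1) x = depth n x + 1} :=
      (measurableSet_forall_le_eq n y).inter (measurableSet_depth_up n)
    rw [Measure.map_apply hm hs, Measure.map_apply hm (measurableSet_forall_le_eq n y)]
    exact measure_depth_up hT hV hVunif hindep n y

end SpineProcess

open Preorder Finset in
/-- A consistent sequence of laws on trajectories extends to a law on trajectories. -/
theorem exists_law_of_consistent {X : ℕ → Type*} [∀ n, MeasurableSpace (X n)]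
    [∀ n, StandardBorelSpace (X n)] [∀ n, Nonempty (X n)] (ν : ℕ → Measure (Π n, X n))
    [∀ n, IsProbabilityMeasure (ν n)]
    (h : ∀ n, (ν (n + 1)).map (frestrictLe n) = (ν n).map (frestrictLe n)) :
    ∃ Q : Measure (Π n, X n), IsProbabilityMeasure Q ∧
      ∀ n, Q.map (frestrictLe n) = (ν n).map (frestrictLe n) := by
  let κ : (n : ℕ) → Kernel (Π i : Iic n, X i) (X (n + 1)) := fun n =>
    condDistrib (fun x => x (n + 1)) (frestrictLe n) (ν (n + 1))
  have hp : IsProbabilityMeasure ((ν 0).map fun x => x 0) :=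
    Measure.isProbabilityMeasure_map (measurable_pi_apply 0).aemeasurable
  have hκ : ∀ n, IsMarkovKernel (κ n) := fun n => by dsimp only [κ]; infer_instance
  refine ⟨Kernel.trajMeasure ((ν 0).map fun x => x 0) κ, inferInstance, fun n => ?_⟩
  induction n with
  | zero =>
    rw [Kernel.trajMeasure, Measure.map_comp _ _ (by fun_prop), Kernel.traj_map_frestrictLe,
      Kernel.partialTraj_self, Measure.id_comp]
    refine (Measure.map_map (MeasurableEquiv.measurable _) (measurable_pi_apply 0)).trans ?_
    congr 1
    ext x i
    obtain ⟨i, hi⟩ := i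
    obtain rfl : i = 0 := by simpa using hi
    rfl
  | succ n ih =>
    let φ : (Π i : Iic n, X i) × X (n + 1) → Π i : Iic (n + 1), X i := fun y =>
      IicProdIoc n (n + 1) (y.1, MeasurableEquiv.piSingleton n y.2)
    have hφ : Measurable φ := by fun_prop
    have e : (frestrictLe (n + 1) : (Π n, X n) → _) =
        φ ∘ fun x => (frestrictLe n x, x (n + 1)) := by
      ext x i
      obtain ⟨i, hi⟩ := i
      simp only [φ, IicProdIoc, Function.comp, frestrictLe_apply]
      split_ifs with h1
      · rfl
      · obtain rfl : i = n + 1 := by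
          have := mem_Iic.1 hi
          omega
        rfl
    have step : ∀ μ : Measure (Π n, X n), μ.map (frestrictLe (n + 1)) =
        (μ.map fun x => (frestrictLe n x, x (n + 1))).map φ := fun μ => by
      rw [Measure.map_map hφ (by fun_prop), ← e]
    rw [step, step, ← Kernel.map_frestrictLe_trajMeasure_compProd_eq_map_trajMeasure, ih, ← h,
      compProd_map_condDistrib (measurable_pi_apply (n + 1)).aemeasurable]
section Tilt

open Preorder

lemma normConst_succ (n : ℕ) (z : ℝ) :
    normConst (n + 1) z = normConst n z * (((n : ℝ) + 2 * z) / ((n : ℝ) + 1)) :=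
  Finset.prod_range_succ _ _

lemma normConst_pos {z : ℝ} (hz : 0 < z) (n : ℕ) : 0 < normConst n z :=
  Finset.prod_pos fun k _ => by positivity

/-- The current depth, as a function of the trajectory up to time `n`. -/
def lastDepth (n : ℕ) (y : (i : Finset.Iic n) → MarkedTree) : ℕ :=
  (y ⟨n, Finset.mem_Iic.2 le_rfl⟩).spine.length

variable {P₀ : Measure Path} [IsProbabilityMeasure P₀]

lemma IsRecordLaw.map_restrict_up {P₀ : Measure Path} (h : IsRecordLaw P₀) (n : ℕ) :
    (P₀.restrict {x | depth (n + 1) x = depth n x + 1}).map (frestrictLe n) =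
      ((n : ℝ≥0∞) + 1)⁻¹ • P₀.map (frestrictLe n) := by
  refine Measure.ext_of_singleton fun y => ?_
  have hR : Measurable (frestrictLe (π := fun _ : ℕ => MarkedTree) n) := measurable_frestrictLe n
  rw [Measure.smul_apply, Measure.map_apply hR (measurableSet_singleton y),
    Measure.map_apply hR (measurableSet_singleton y),
    Measure.restrict_apply (hR (measurableSet_singleton y)), smul_eq_mul]
  let y' : Path := fun j => if hj : j ≤ n then y ⟨j, Finset.mem_Iic.2 hj⟩ else Classical.arbitrary _
  have hy : ∀ x : Path, frestrictLe n x = y ↔ ∀ j ≤ n, x j = y' j := by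
    intro x
    rw [funext_iff]
    constructor
    · intro hx j hj
      simpa [y', hj] using hx ⟨j, Finset.mem_Iic.2 hj⟩
    · rintro hx ⟨j, hj⟩
      have hj' := Finset.mem_Iic.1 hj
      simpa [y', hj'] using hx j hj'
  have e1 : frestrictLe (π := fun _ : ℕ => MarkedTree) n ⁻¹' {y} =
      {x : Path | ∀ j ≤ n, x j = y' j} := Set.ext fun x => hy x
  have e2 : frestrictLe (π := fun _ : ℕ => MarkedTree) n ⁻¹' {y} ∩
      {x | depth (n + 1) x = depth n x + 1} =
      {x : Path | (∀ j ≤ n, x j = y' j) ∧ depth (n + 1) x = depth n x + 1} :=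
    Set.ext fun x => and_congr_left fun _ => hy x
  rw [e2, e1]
  exact h.up n y'

lemma IsRecordLaw.map_restrict_stay (h : IsRecordLaw P₀) (n : ℕ) :
    (P₀.restrict {x | depth (n + 1) x = depth n x + 1}ᶜ).map (frestrictLe n) =
      ((n : ℝ≥0∞) * ((n : ℝ≥0∞) + 1)⁻¹) • P₀.map (frestrictLe n) := by
  have hR : Measurable (frestrictLe (π := fun _ : ℕ => MarkedTree) n) := measurable_frestrictLe n
  have hadd := Measure.restrict_add_restrict_compl (μ := P₀) (measurableSet_depth_up n)
  ext A hA
  have h1 := congrArg (fun μ : Measure Path => μ.map (frestrictLe n) A) hadd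
  simp only [Measure.map_add _ _ hR] at h1
  rw [Measure.add_apply, h.map_restrict_up] at h1
  rw [Measure.smul_apply, smul_eq_mul] at h1 ⊢
  set b := P₀.map (frestrictLe n) A with hb
  have hfin : b ≠ ∞ := by
    have : IsProbabilityMeasure (P₀.map (frestrictLe n)) :=
      Measure.isProbabilityMeasure_map hR.aemeasurable
    exact measure_ne_top _ _
  have h2 : ((n : ℝ≥0∞) + 1)⁻¹ * b + (n : ℝ≥0∞) * ((n : ℝ≥0∞) + 1)⁻¹ * b = b := by
    rw [← add_mul]
    have : ((n : ℝ≥0∞) + 1)⁻¹ + (n : ℝ≥0∞) * ((n : ℝ≥0∞) + 1)⁻¹ = 1 := by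
      rw [add_comm, ← add_one_mul, ENNReal.mul_inv_cancel (by positivity) (by finiteness)]
    rw [this, one_mul]
  have h3 : ((n : ℝ≥0∞) + 1)⁻¹ * b ≠ ∞ :=
    ENNReal.mul_ne_top (ENNReal.inv_ne_top.2 (by positivity)) hfin
  exact (ENNReal.add_right_inj h3).1 (h1.trans h2.symm)

/-- The one-step formula of the depth of the spine. -/
theorem IsRecordLaw.lintegral_succ (h : IsRecordLaw P₀) (n : ℕ)
    (g : ((i : Finset.Iic n) → MarkedTree) → ℝ≥0∞) (F : ℕ → ℝ≥0∞) :
    ∫⁻ x, g (frestrictLe n x) * F (depth (n + 1) x) ∂P₀ =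
      ENNReal.ofReal (n / (n + 1)) * ∫⁻ x, g (frestrictLe n x) * F (depth n x) ∂P₀ +
      ENNReal.ofReal (1 / (n + 1)) * ∫⁻ x, g (frestrictLe n x) * F (depth n x + 1) ∂P₀ := by
  have hR : Measurable (frestrictLe (π := fun _ : ℕ => MarkedTree) n) := measurable_frestrictLe n
  have hU := measurableSet_depth_up n
  have ec1 : ENNReal.ofReal (1 / ((n : ℝ) + 1)) = ((n : ℝ≥0∞) + 1)⁻¹ := by
    rw [one_div, ENNReal.ofReal_inv_of_pos (by positivity), ENNReal.ofReal_add (by positivity)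
      (by positivity), ENNReal.ofReal_natCast, ENNReal.ofReal_one]
  have ec0 : ENNReal.ofReal ((n : ℝ) / ((n : ℝ) + 1)) = (n : ℝ≥0∞) * ((n : ℝ≥0∞) + 1)⁻¹ := by
    rw [← ec1, ← ENNReal.ofReal_natCast, ← ENNReal.ofReal_mul (by positivity), mul_one_div]
  have key : ∀ (G : ((i : Finset.Iic n) → MarkedTree) → ℝ≥0∞) (U : Set Path) (c : ℝ≥0∞),
      (P₀.restrict U).map (frestrictLe n) = c • P₀.map (frestrictLe n) →
      ∫⁻ x in U, G (frestrictLe n x) ∂P₀ = c * ∫⁻ x, G (frestrictLe n x) ∂P₀ := by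
    intro G U c hc
    have hG : Measurable G := Measurable.of_discrete
    rw [← lintegral_map (f := G) hG hR, ← lintegral_map (f := G) hG hR, hc,
      lintegral_smul_measure, smul_eq_mul]
  rw [← lintegral_add_compl _ hU, add_comm, ec0, ec1]
  congr 1
  · refine Eq.trans ?_ (key (fun y => g y * F (lastDepth n y)) _ _ (h.map_restrict_stay n))
    refine lintegral_congr_ae ?_
    filter_upwards [ae_restrict_mem hU.compl, ae_restrict_of_ae h.depth_succ] with x h1 h2
    have h3 : depth (n + 1) x = depth n x := (h2 n).resolve_right h1
    rw [h3]
    rfl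
  · refine Eq.trans ?_ (key (fun y => g y * F (lastDepth n y + 1)) _ _ (h.map_restrict_up n))
    refine lintegral_congr_ae ?_
    filter_upwards [ae_restrict_mem hU] with x h1
    have h3 : depth (n + 1) x = depth n x + 1 := h1
    rw [h3]
    rfl

/-- The martingale property of `ℰ_n(z)`. -/
lemma IsRecordLaw.lintegral_expMart_succ (h : IsRecordLaw P₀) {z : ℝ} (hz : 0 < z) (n : ℕ)
    (g : ((i : Finset.Iic n) → MarkedTree) → ℝ≥0∞) :
    ∫⁻ x, g (frestrictLe n x) * ENNReal.ofReal (expMart z (n + 1) x) ∂P₀ =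
      ∫⁻ x, g (frestrictLe n x) * ENNReal.ofReal (expMart z n x) ∂P₀ := by
  have hN := normConst_pos hz n
  have hm : ∀ F : ℕ → ℝ≥0∞, Measurable fun x : Path => g (frestrictLe n x) * F (depth n x) :=
    fun F => ((Measurable.of_discrete (f := g)).comp (measurable_frestrictLe n)).mul
      ((Measurable.of_discrete (f := F)).comp (measurable_depth n))
  have e := h.lintegral_succ n g fun k => ENNReal.ofReal ((2 * z) ^ k / normConst (n + 1) z)
  refine e.trans ?_
  rw [← lintegral_const_mul _ (hm fun k => ENNReal.ofReal ((2 * z) ^ k / normConst (n + 1) z)),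
    ← lintegral_const_mul _ (hm fun k => ENNReal.ofReal ((2 * z) ^ (k + 1) / normConst (n + 1) z)),
    ← lintegral_add_left ((hm fun k =>
      ENNReal.ofReal ((2 * z) ^ k / normConst (n + 1) z)).const_mul _)]
  refine lintegral_congr fun x => ?_
  rw [mul_left_comm, mul_left_comm (ENNReal.ofReal (1 / (n + 1))), ← mul_add,
    ← ENNReal.ofReal_mul (by positivity), ← ENNReal.ofReal_mul (by positivity),
    ← ENNReal.ofReal_add]
  · congr 2
    rw [expMart, normConst_succ]
    field_simp
    ring
  · have := normConst_pos hz (n + 1)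
    positivity
  · have := normConst_pos hz (n + 1)
    positivity

lemma measurable_expMart (z : ℝ) (n : ℕ) : Measurable (expMart z n) :=
  (Measurable.of_discrete (f := fun k : ℕ => (2 * z) ^ k / normConst n z)).comp (measurable_depth n)

lemma IsRecordLaw.lintegral_expMart (h : IsRecordLaw P₀) {z : ℝ} (hz : 0 < z) (n : ℕ) :
    ∫⁻ x, ENNReal.ofReal (expMart z n x) ∂P₀ = 1 := by
  induction n with
  | zero =>
    have : ∀ᵐ x ∂P₀, ENNReal.ofReal (expMart z 0 x) = 1 := by
      filter_upwards [h.depth_zero] with x hx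
      simp [expMart, normConst, hx]
    rw [lintegral_congr_ae this]
    simp
  | succ n ih =>
    rw [← ih]
    simpa using h.lintegral_expMart_succ hz n fun _ => 1

lemma isTiltedLaw_iff {P₀ Q : Measure Path} {z : ℝ} :
    IsTiltedLaw z P₀ Q ↔ ∀ n, Q.map (frestrictLe n) =
      (P₀.withDensity fun x => ENNReal.ofReal (expMart z n x)).map (frestrictLe n) := by
  have hR : ∀ n, Measurable (frestrictLe (π := fun _ : ℕ => MarkedTree) n) := measurable_frestrictLe
  constructor
  · intro h n
    ext B hB
    rw [Measure.map_apply (hR n) hB, Measure.map_apply (hR n) hB,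
      withDensity_apply _ (hR n hB)]
    refine h n _ ?_
    rw [Filtration.piLE_eq_comap_frestrictLe]
    exact ⟨B, hB, rfl⟩
  · intro h n A hA
    rw [Filtration.piLE_eq_comap_frestrictLe] at hA
    obtain ⟨B, hB, rfl⟩ := hA
    rw [← withDensity_apply _ (hR n hB), ← Measure.map_apply (hR n) hB, h,
      Measure.map_apply (hR n) hB]

theorem IsRecordLaw.existsUnique_tiltedLaw (h : IsRecordLaw P₀) {z : ℝ} (hz : 0 < z) :
    ∃! Q : ProbabilityMeasure Path, IsTiltedLaw z P₀ (Q : Measure Path) := by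
  let ν : ℕ → Measure Path := fun n => P₀.withDensity fun x => ENNReal.ofReal (expMart z n x)
  have hν : ∀ n, IsProbabilityMeasure (ν n) := fun n =>
    ⟨by rw [withDensity_apply _ MeasurableSet.univ, setLIntegral_univ,
      h.lintegral_expMart hz n]⟩
  have hR : ∀ n, Measurable (frestrictLe (π := fun _ : ℕ => MarkedTree) n) := measurable_frestrictLe
  have hcons : ∀ n, (ν (n + 1)).map (frestrictLe n) = (ν n).map (frestrictLe n) := by
    intro n
    ext B hB
    have key : ∀ m, (ν m).map (frestrictLe n) B = ∫⁻ x,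
        B.indicator 1 (frestrictLe n x) * ENNReal.ofReal (expMart z m x) ∂P₀ := by
      intro m
      rw [Measure.map_apply (hR n) hB, withDensity_apply _ (hR n hB),
        ← lintegral_indicator (hR n hB)]
      refine lintegral_congr fun x => ?_
      by_cases hx : frestrictLe n x ∈ B <;> simp [Set.indicator, hx]
    rw [key, key]
    exact h.lintegral_expMart_succ hz n _
  obtain ⟨Q, hQ, hQν⟩ := exists_law_of_consistent (X := fun _ => MarkedTree) ν hcons
  refine ⟨⟨Q, hQ⟩, isTiltedLaw_iff.2 hQν, fun Q' hQ' => ?_⟩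
  replace hQ' := isTiltedLaw_iff.1 hQ'
  refine Subtype.ext ?_
  have hfam : ∀ (n : ℕ), (Q' : Measure Path).map (frestrictLe n) = Q.map (frestrictLe n) :=
    fun n => (hQ' n).trans (hQν n).symm
  refine IsProjectiveLimit.unique (P := fun I => (Q' : Measure Path).map I.restrict)
    (fun I => rfl) fun I => ?_
  have hI : I ⊆ Finset.Iic (I.sup id) := I.subset_Iic_sup_id
  change Q.map I.restrict = (Q' : Measure Path).map I.restrict
  rw [← Finset.restrict₂_comp_restrict hI, ← Measure.map_map (by fun_prop) (by fun_prop),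
    ← Measure.map_map (by fun_prop) (by fun_prop)]
  exact congrArg _ (hfam _).symm

end Tilt

section DepthLaw

/-- The law of a sum of independent Bernoulli variables with parameters `a / (k + a)`, `k < n`. -/
noncomputable def depthLaw (a : ℝ) : ℕ → Measure ℕ
  | 0 => Measure.dirac 0
  | n + 1 => ENNReal.ofReal (n / (n + a)) • depthLaw a n +
      ENNReal.ofReal (a / (n + a)) • (depthLaw a n).map (· + 1)

/-- The product `∏_{k < n} (k + b) / (k + a)`. -/
noncomputable def depthRatio (a b : ℝ) (n : ℕ) : ℝ :=
  ∏ k ∈ Finset.range n, ((k : ℝ) + b) / ((k : ℝ) + a)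

variable {a b : ℝ}

lemma depthRatio_pos (ha : 0 < a) (hb : 0 < b) (n : ℕ) : 0 < depthRatio a b n :=
  Finset.prod_pos fun k _ => by positivity

lemma depthRatio_succ (a b : ℝ) (n : ℕ) :
    depthRatio a b (n + 1) = depthRatio a b n * (((n : ℝ) + b) / ((n : ℝ) + a)) :=
  Finset.prod_range_succ _ _

lemma lintegral_depthLaw_succ (a : ℝ) (n : ℕ) (f : ℕ → ℝ≥0∞) :
    ∫⁻ k, f k ∂(depthLaw a (n + 1)) = ENNReal.ofReal (n / (n + a)) * ∫⁻ k, f k ∂(depthLaw a n) +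
      ENNReal.ofReal (a / (n + a)) * ∫⁻ k, f (k + 1) ∂(depthLaw a n) := by
  rw [depthLaw, lintegral_add_measure, lintegral_smul_measure, lintegral_smul_measure,
    lintegral_map Measurable.of_discrete Measurable.of_discrete, smul_eq_mul, smul_eq_mul]

lemma isProbabilityMeasure_depthLaw (ha : 0 < a) (n : ℕ) : IsProbabilityMeasure (depthLaw a n) := by
  induction n with
  | zero => rw [depthLaw]; infer_instance
  | succ n ih =>
    refine ⟨?_⟩
    have h := lintegral_depthLaw_succ a n fun _ => 1
    simp only [lintegral_const, measure_univ, one_mul, mul_one] at h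
    rw [h, ← ENNReal.ofReal_add (by positivity) (by positivity), ← add_div,
      div_self (by positivity), ENNReal.ofReal_one]

/-- The change of measure between two parameters. -/
theorem lintegral_depthLaw_tilt (ha : 0 < a) (hb : 0 < b) (n : ℕ) (f : ℕ → ℝ≥0∞) :
    ∫⁻ k, f k ∂(depthLaw b n) =
      ∫⁻ k, f k * ENNReal.ofReal ((b / a) ^ k / depthRatio a b n) ∂(depthLaw a n) := by
  induction n generalizing f with
  | zero => simp [depthLaw, depthRatio]
  | succ n ih =>
    have hr := depthRatio_pos ha hb n
    rw [lintegral_depthLaw_succ, lintegral_depthLaw_succ, ih, ih,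
      ← lintegral_const_mul _ Measurable.of_discrete,
      ← lintegral_const_mul _ Measurable.of_discrete,
      ← lintegral_const_mul _ Measurable.of_discrete,
      ← lintegral_const_mul _ Measurable.of_discrete]
    congr 1 <;> refine lintegral_congr fun k => ?_
    · rw [mul_left_comm, mul_left_comm (ENNReal.ofReal (n / (n + a))),
        ← ENNReal.ofReal_mul (by positivity), ← ENNReal.ofReal_mul (by positivity)]
      congr 2
      rw [depthRatio_succ]
      field_simp
    · rw [mul_left_comm, mul_left_comm (ENNReal.ofReal (a / (n + a))),
        ← ENNReal.ofReal_mul (by positivity), ← ENNReal.ofReal_mul (by positivity)]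
      congr 2
      rw [depthRatio_succ]
      rw [pow_succ]
      field_simp

lemma IsRecordLaw.map_depth {P₀ : Measure Path} [IsProbabilityMeasure P₀] (h : IsRecordLaw P₀)
    (n : ℕ) : P₀.map (depth n) = depthLaw 1 n := by
  have key : ∀ f : ℕ → ℝ≥0∞, ∫⁻ x, f (depth n x) ∂P₀ = ∫⁻ k, f k ∂(depthLaw 1 n) := by
    induction n with
    | zero =>
      intro f
      have : ∀ᵐ x ∂P₀, f (depth 0 x) = f 0 := by
        filter_upwards [h.depth_zero] with x hx
        rw [hx]
      rw [lintegral_congr_ae this]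
      simp [depthLaw]
    | succ n ih =>
      intro f
      rw [lintegral_depthLaw_succ, ← ih, ← ih fun k => f (k + 1)]
      simpa using h.lintegral_succ n (fun _ => 1) f
  refine Measure.ext_of_lintegral _ fun f hf => ?_
  rw [lintegral_map hf (measurable_depth n), key]

theorem IsTiltedLaw.map_depth {P₀ Q : Measure Path} [IsProbabilityMeasure P₀] {z : ℝ} (hz : 0 < z)
    (h : IsRecordLaw P₀) (hQ : IsTiltedLaw z P₀ Q) (n : ℕ) :
    Q.map (depth n) = depthLaw (2 * z) n := by
  have hm := Preorder.measurable_frestrictLe (X := fun _ : ℕ => MarkedTree) n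
  have hl : Measurable (lastDepth n) := Measurable.of_discrete
  have e : depth n = lastDepth n ∘ Preorder.frestrictLe n := rfl
  have h1 : Q.map (depth n) =
      (P₀.withDensity fun x => ENNReal.ofReal (expMart z n x)).map (depth n) := by
    rw [e, ← Measure.map_map hl hm, ← Measure.map_map hl hm, isTiltedLaw_iff.1 hQ]
  refine h1.trans (Measure.ext_of_lintegral _ fun f hf => ?_)
  rw [lintegral_map hf (measurable_depth n)]
  refine (lintegral_withDensity_eq_lintegral_mul _ (measurable_expMart z n).ennreal_ofReal
    (hf.comp (measurable_depth n))).trans ?_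
  rw [lintegral_depthLaw_tilt one_pos (by positivity), ← h.map_depth,
    lintegral_map Measurable.of_discrete (measurable_depth n)]
  refine lintegral_congr fun x => ?_
  rw [Pi.mul_apply, mul_comm, div_one]
  rfl

lemma IsTiltedLaw.ae_monotone_depth {P₀ Q : Measure Path} {z : ℝ} (h : IsRecordLaw P₀)
    (hQ : IsTiltedLaw z P₀ Q) : ∀ᵐ x ∂Q, Monotone fun n => depth n x := by
  have key : ∀ n, ∀ᵐ x ∂Q, depth n x ≤ depth (n + 1) x := by
    intro n
    rw [ae_iff]
    let S : Set ((i : Finset.Iic (n + 1)) → MarkedTree) :=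
      {y | ¬ (y ⟨n, Finset.mem_Iic.2 n.le_succ⟩).spine.length ≤ lastDepth (n + 1) y}
    have hS : MeasurableSet S := MeasurableSet.of_discrete
    rw [show {x | ¬ depth n x ≤ depth (n + 1) x} =
      Preorder.frestrictLe (π := fun _ : ℕ => MarkedTree) (n + 1) ⁻¹' S from rfl,
      hQ (n + 1) _ (by rw [Filtration.piLE_eq_comap_frestrictLe]; exact ⟨S, hS, rfl⟩)]
    refine setLIntegral_measure_zero _ _ ?_
    rw [measure_eq_zero_iff_ae_notMem]
    filter_upwards [h.depth_succ] with x hx hxS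
    refine hxS ?_
    change depth n x ≤ depth (n + 1) x
    rcases hx n with h | h <;> omega
  filter_upwards [ae_all_iff.2 key] with x hx
  exact monotone_nat_of_le_succ hx

/-- `∏_{k < n} (k + b) / (k + a)` is asymptotically proportional to `n ^ (b - a)`. -/
lemma tendsto_depthRatio (ha : 0 < a) (hb : 0 < b) :
    Tendsto (fun n : ℕ => depthRatio a b n / (n : ℝ) ^ (b - a)) atTop
      (𝓝 (Real.Gamma a / Real.Gamma b)) := by
  have h1 := (Real.GammaSeq_tendsto_Gamma a).div (Real.GammaSeq_tendsto_Gamma b)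
    (Real.Gamma_pos_of_pos hb).ne'
  have h2 : Tendsto (fun n : ℕ => ((n : ℝ) + a) / ((n : ℝ) + b)) atTop (𝓝 1) := by
    have : Tendsto (fun n : ℕ => 1 + (a - b) / ((n : ℝ) + b)) atTop (𝓝 (1 + 0)) :=
      tendsto_const_nhds.add (tendsto_const_nhds.div_atTop
        (tendsto_atTop_add_const_right _ _ tendsto_natCast_atTop_atTop))
    rw [add_zero] at this
    refine this.congr fun n => ?_
    field_simp
    ring
  have h3 := h1.mul h2
  rw [mul_one] at h3
  refine h3.congr' ?_
  filter_upwards [eventually_gt_atTop 0] with n hn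
  have hn' : (0 : ℝ) < n := by exact_mod_cast hn
  have hA : 0 < ∏ j ∈ Finset.range n, (a + (j : ℝ)) := Finset.prod_pos fun k _ => by positivity
  have hB : 0 < ∏ j ∈ Finset.range n, (b + (j : ℝ)) := Finset.prod_pos fun k _ => by positivity
  simp only [Pi.div_apply, Real.GammaSeq, Finset.prod_range_succ, depthRatio,
    Finset.prod_div_distrib, Real.rpow_sub hn', add_comm _ a, add_comm _ b]
  have h4 : (0 : ℝ) < (n.factorial : ℝ) := by exact_mod_cast n.factorial_pos
  have h5 : (0 : ℝ) < (n : ℝ) ^ a := Real.rpow_pos_of_pos hn' _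
  have h6 : (0 : ℝ) < (n : ℝ) ^ b := Real.rpow_pos_of_pos hn' _
  field_simp

lemma eventually_depthRatio_le (ha : 0 < a) (hb : 0 < b) {e : ℝ} (he : b - a < e) :
    ∀ᶠ n : ℕ in atTop, depthRatio a b n ≤ (n : ℝ) ^ e := by
  have h1 : Tendsto (fun n : ℕ => (n : ℝ) ^ (e - (b - a))) atTop atTop :=
    (tendsto_rpow_atTop (sub_pos.2 he)).comp tendsto_natCast_atTop_atTop
  have h2 := (tendsto_depthRatio ha hb).eventually_lt_const (lt_add_one _)
  filter_upwards [h2, h1.eventually_ge_atTop (Real.Gamma a / Real.Gamma b + 1),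
    eventually_gt_atTop 0] with n h3 h4 hn
  have hn' : (0 : ℝ) < n := by exact_mod_cast hn
  have h5 : (0 : ℝ) < (n : ℝ) ^ (b - a) := Real.rpow_pos_of_pos hn' _
  have h6 := (div_lt_iff₀ h5).1 (h3.trans_le h4)
  rw [← Real.rpow_add hn', sub_add_cancel] at h6
  exact h6.le

lemma depthRatio_inv (a b : ℝ) (n : ℕ) : (depthRatio a b n)⁻¹ = depthRatio b a n := by
  rw [depthRatio, depthRatio, ← Finset.prod_inv_distrib]
  exact Finset.prod_congr rfl fun k _ => inv_div _ _

lemma pow_eq_exp {t : ℝ} (ht : 0 < t) (k : ℕ) : t ^ k = Real.exp (k * Real.log t) := by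
  rw [← Real.rpow_natCast, Real.rpow_def_of_pos ht, mul_comm]

lemma depthLaw_apply_tilt (ha : 0 < a) (hb : 0 < b) (n : ℕ) (S : Set ℕ) :
    depthLaw a n S =
      ∫⁻ k in S, ENNReal.ofReal ((a / b) ^ k * depthRatio a b n) ∂(depthLaw b n) := by
  have h := lintegral_depthLaw_tilt hb ha n (S.indicator 1)
  rw [lintegral_indicator_one MeasurableSet.of_discrete] at h
  rw [h, ← lintegral_indicator MeasurableSet.of_discrete]
  refine lintegral_congr fun k => ?_
  simp only [← depthRatio_inv b a, ← div_eq_mul_inv]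
  by_cases hk : k ∈ S <;> simp [hk]

/-- The exponential Markov inequality for `depthLaw`, in terms of the tilting parameter `b`. -/
lemma eventually_depthLaw_le (ha : 0 < a) (hb : 0 < b) {x e : ℝ}
    (he : x * Real.log (a / b) + (b - a) < e) :
    ∀ᶠ n : ℕ in atTop, ∀ S : Set ℕ,
      (∀ k ∈ S, (k : ℝ) * Real.log (a / b) ≤ x * Real.log n * Real.log (a / b)) →
      depthLaw a n S ≤ ENNReal.ofReal ((n : ℝ) ^ e) := by
  filter_upwards [eventually_depthRatio_le ha hb (e := e - x * Real.log (a / b)) (by linarith),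
    eventually_gt_atTop 0] with n h1 hn S hS
  have hn' : (0 : ℝ) < n := by exact_mod_cast hn
  have := isProbabilityMeasure_depthLaw hb n
  rw [depthLaw_apply_tilt ha hb]
  calc _ ≤ ∫⁻ k in S, ENNReal.ofReal ((n : ℝ) ^ e) ∂(depthLaw b n) := by
        refine setLIntegral_mono' MeasurableSet.of_discrete fun k hk => ?_
        refine ENNReal.ofReal_le_ofReal ?_
        calc (a / b) ^ k * depthRatio a b n
            ≤ (n : ℝ) ^ (x * Real.log (a / b)) * (n : ℝ) ^ (e - x * Real.log (a / b)) := by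
              refine mul_le_mul ?_ h1 (depthRatio_pos ha hb n).le (by positivity)
              rw [pow_eq_exp (by positivity), Real.rpow_def_of_pos hn', Real.exp_le_exp]
              linarith [hS k hk]
          _ = (n : ℝ) ^ e := by rw [← Real.rpow_add hn']; ring_nf
    _ ≤ ENNReal.ofReal ((n : ℝ) ^ e) := by
        rw [setLIntegral_const]
        exact mul_le_of_le_one_right zero_le prob_le_one

lemma eventually_le_depthLaw (ha : 0 < a) (hb : 0 < b) {x e : ℝ}
    (he : e < x * Real.log (a / b) + (b - a)) :
    ∃ δ > 0, ∀ᶠ n : ℕ in atTop, ∀ S : Set ℕ,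
      (∀ k ∈ S, |(k : ℝ) - x * Real.log n| ≤ δ * Real.log n) →
      ENNReal.ofReal ((n : ℝ) ^ e) * depthLaw b n S ≤ depthLaw a n S := by
  set L := Real.log (a / b) with hL
  set g := x * L + (b - a) - e with hg
  have hgpos : 0 < g := by linarith
  have hLp : 0 < |L| + 1 := by positivity
  refine ⟨g / (2 * (|L| + 1)), by positivity, ?_⟩
  filter_upwards [eventually_depthRatio_le hb ha (e := a - b + g / 2) (by linarith),
    eventually_gt_atTop 0] with n h1 hn S hS
  have hn' : (0 : ℝ) < n := by exact_mod_cast hn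
  have hlog : 0 ≤ Real.log n := Real.log_natCast_nonneg n
  rw [depthLaw_apply_tilt ha hb, ← setLIntegral_const]
  refine setLIntegral_mono' MeasurableSet.of_discrete fun k hk => ENNReal.ofReal_le_ofReal ?_
  have h2 : (n : ℝ) ^ (b - a - g / 2) ≤ depthRatio a b n := by
    rw [← depthRatio_inv b a, show b - a - g / 2 = -(a - b + g / 2) by ring, Real.rpow_neg hn'.le]
    exact inv_anti₀ (depthRatio_pos hb ha n) h1
  have h3 : (n : ℝ) ^ (x * L - g / 2) ≤ (a / b) ^ k := by
    rw [pow_eq_exp (by positivity), Real.rpow_def_of_pos hn', Real.exp_le_exp, ← hL]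
    have h4 : |((k : ℝ) - x * Real.log n) * L| ≤ g / 2 * Real.log n := by
      rw [abs_mul]
      calc |(k : ℝ) - x * Real.log n| * |L| ≤ g / (2 * (|L| + 1)) * Real.log n * (|L| + 1) :=
            mul_le_mul (hS k hk) (by linarith) (abs_nonneg _) (by positivity)
        _ = g / 2 * Real.log n := by field_simp
    linarith [(abs_le.1 h4).1]
  calc (n : ℝ) ^ e = (n : ℝ) ^ (x * L - g / 2) * (n : ℝ) ^ (b - a - g / 2) := by
        rw [← Real.rpow_add hn']; congr 1; rw [hg]; ring
    _ ≤ _ := mul_le_mul h3 h2 (by positivity) (by positivity)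

end DepthLaw

section LargeDeviations

variable {a : ℝ}

lemma eta_zero (a : ℝ) : eta a 0 = a := by simp [eta]

lemma eta_self (ha : 0 < a) : eta a a.toNNReal = 0 := by
  simp [eta, Real.coe_toNNReal a ha.le, div_self ha.ne']

lemma eta_eq (a : ℝ) (x : ℝ≥0) :
    eta a x = -((x : ℝ) * Real.log (a / x) + (x - a)) := by
  have : Real.log (a / x) = -Real.log (x / a) := by rw [← Real.log_inv, inv_div]
  rw [eta, this]
  ring

lemma eta_pos (ha : 0 < a) {x : ℝ≥0} (hx : (x : ℝ) ≠ a) : 0 < eta a x := by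
  rcases eq_or_lt_of_le (zero_le (a := x)) with h0 | h0
  · rw [← h0, eta_zero]; exact ha
  · have hx0 : (0 : ℝ) < x := h0
    rw [eta_eq]
    have h1 : Real.log (a / x) < a / x - 1 := Real.log_lt_sub_one_of_pos (by positivity) (by
      rw [Ne, div_eq_one_iff_eq hx0.ne']
      exact fun h => hx h.symm)
    have h2 := mul_lt_mul_of_pos_left h1 hx0
    rw [mul_sub, mul_div_cancel₀ _ hx0.ne'] at h2
    linarith

lemma eta_nonneg (ha : 0 < a) (x : ℝ≥0) : 0 ≤ eta a x := by
  by_cases hx : (x : ℝ) = a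
  · rw [← eta_self ha, ← hx, Real.toNNReal_coe]
  · exact (eta_pos ha hx).le

lemma continuous_eta (ha : 0 < a) : Continuous (eta a) := by
  have e : eta a = fun x : ℝ≥0 =>
      (x : ℝ) * Real.log x - (x : ℝ) * Real.log a - (x : ℝ) + a := by
    funext x
    rcases eq_or_lt_of_le (zero_le (a := x)) with h0 | h0
    · simp [← h0, eta]
    · have hx0 : (x : ℝ) ≠ 0 := by exact_mod_cast h0.ne'
      rw [eta, Real.log_div hx0 ha.ne']
      ring
  rw [e]
  have := Real.continuous_mul_log.comp NNReal.continuous_coe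
  simp only [Function.comp_def] at this
  fun_prop

/-- Chernoff bounds for both tails of `depthLaw`. -/
lemma eventually_tail_le (ha : 0 < a) {x : ℝ≥0} {c : ℝ} (hc : c < eta a x) :
    ∀ᶠ n : ℕ in atTop, ∀ S : Set ℕ,
      ((a ≤ x ∧ ∀ k ∈ S, (x : ℝ) * Real.log n ≤ k) ∨
        ((x : ℝ) ≤ a ∧ ∀ k ∈ S, (k : ℝ) ≤ x * Real.log n)) →
      depthLaw a n S ≤ ENNReal.ofReal ((n : ℝ) ^ (-c)) := by
  rcases eq_or_lt_of_le (zero_le (a := x)) with h0 | h0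
  · rw [← h0, eta_zero] at hc
    have hb : 0 < min a ((a - c) / 2) := lt_min ha (by linarith)
    have hba : min a ((a - c) / 2) ≤ (a - c) / 2 := min_le_right _ _
    filter_upwards [eventually_depthLaw_le ha hb (x := 0) (e := -c) (by linarith)] with n hn S hS
    refine hn S fun k hk => ?_
    rw [← h0, NNReal.coe_zero] at hS
    have hL : 0 ≤ Real.log (a / min a ((a - c) / 2)) :=
      Real.log_nonneg ((one_le_div hb).2 (min_le_left _ _))
    rcases hS with ⟨h1, _⟩ | ⟨_, h1⟩
    · linarith
    · exact mul_le_mul_of_nonneg_right (h1 k hk) hL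
  · have hx0 : (0 : ℝ) < x := h0
    rw [eta_eq] at hc
    filter_upwards [eventually_depthLaw_le ha hx0 (x := x) (e := -c) (by linarith)] with n hn S hS
    refine hn S fun k hk => ?_
    rcases hS with ⟨h1, h2⟩ | ⟨h1, h2⟩
    · exact mul_le_mul_of_nonpos_right (h2 k hk)
        (Real.log_nonpos (by positivity) ((div_le_one hx0).2 h1))
    · exact mul_le_mul_of_nonneg_right (h2 k hk) (Real.log_nonneg ((one_le_div hx0).2 h1))

/-- `depthLaw a n` concentrates around `a * log n`, at polynomial speed. -/
theorem eventually_concentration (ha : 0 < a) {δ : ℝ} (hδ : 0 < δ) :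
    ∃ c : ℝ, 0 < c ∧ ∀ᶠ n : ℕ in atTop,
      depthLaw a n {k : ℕ | δ * Real.log n ≤ |(k : ℝ) - a * Real.log n|} ≤
        2 * ENNReal.ofReal ((n : ℝ) ^ (-c)) := by
  let xp : ℝ≥0 := (a + δ).toNNReal
  let xm : ℝ≥0 := (a - δ).toNNReal
  have hxp : (xp : ℝ) = a + δ := Real.coe_toNNReal _ (by linarith)
  have hxm : (xm : ℝ) = max (a - δ) 0 := Real.coe_toNNReal' _
  have hxma : (xm : ℝ) < a := by rw [hxm]; exact max_lt (by linarith) ha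
  have hp := eta_pos ha (x := xp) (by rw [hxp]; linarith)
  have hm := eta_pos ha hxma.ne
  have hc : 0 < min (eta a xp) (eta a xm) / 2 := half_pos (lt_min hp hm)
  refine ⟨_, hc, ?_⟩
  filter_upwards [eventually_tail_le ha (x := xp) (c := min (eta a xp) (eta a xm) / 2)
      (by have := min_le_left (eta a xp) (eta a xm); linarith),
    eventually_tail_le ha (x := xm) (c := min (eta a xp) (eta a xm) / 2)
      (by have := min_le_right (eta a xp) (eta a xm); linarith)] with n h1 h2
  have hlog : 0 ≤ Real.log n := Real.log_natCast_nonneg n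
  rw [two_mul]
  refine le_trans (le_trans (measure_mono ?_) (measure_union_le _ _)) (add_le_add
    (h1 {k | (xp : ℝ) * Real.log n ≤ k} (Or.inl ⟨by linarith, fun k hk => hk⟩))
    (h2 {k | (k : ℝ) ≤ xm * Real.log n} (Or.inr ⟨hxma.le, fun k hk => hk⟩)))
  intro k hk
  have hk' : δ * Real.log n ≤ |(k : ℝ) - a * Real.log n| := hk
  rcases le_abs.1 hk' with h | h
  · refine Or.inl ?_
    change (xp : ℝ) * Real.log n ≤ k
    rw [hxp]; linarith
  · refine Or.inr ?_
    change (k : ℝ) ≤ xm * Real.log n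
    have : (a - δ) * Real.log n ≤ xm * Real.log n :=
      mul_le_mul_of_nonneg_right (by rw [hxm]; exact le_max_left _ _) hlog
    linarith

/-- The depth divided by `log n`. -/
noncomputable def scaledDepth (n k : ℕ) : ℝ≥0 := (k : ℝ≥0) / (Real.log n).toNNReal

lemma coe_scaledDepth (n k : ℕ) : (scaledDepth n k : ℝ) = k / Real.log n := by
  simp [scaledDepth, Real.coe_toNNReal _ (Real.log_natCast_nonneg n)]

lemma eventually_closed_le (ha : 0 < a) {F : Set ℝ≥0} (hF : IsClosed F) {c : ℝ}
    (hc : ∀ x ∈ F, c < eta a x) :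
    ∀ᶠ n : ℕ in atTop, depthLaw a n (scaledDepth n ⁻¹' F) ≤ ENNReal.ofReal (2 * (n : ℝ) ^ (-c)) := by
  have hlogpos : ∀ᶠ n : ℕ in atTop, 0 < Real.log n :=
    (Real.tendsto_log_atTop.comp tendsto_natCast_atTop_atTop).eventually_gt_atTop 0
  have hup : ∀ᶠ n : ℕ in atTop,
      depthLaw a n (scaledDepth n ⁻¹' (F ∩ {x | a ≤ x})) ≤ ENNReal.ofReal ((n : ℝ) ^ (-c)) := by
    have hcl : IsClosed (F ∩ {x : ℝ≥0 | a ≤ x}) :=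
      hF.inter (isClosed_le continuous_const NNReal.continuous_coe)
    rcases (F ∩ {x : ℝ≥0 | a ≤ x}).eq_empty_or_nonempty with he | hne
    · simp [he]
    · have hmem := hcl.csInf_mem hne (OrderBot.bddBelow _)
      filter_upwards [eventually_tail_le ha (hc _ hmem.1), hlogpos] with n hn hl
      refine hn _ (Or.inl ⟨hmem.2, fun k hk => ?_⟩)
      have h1 : sInf (F ∩ {x : ℝ≥0 | a ≤ x}) ≤ scaledDepth n k :=
        csInf_le (OrderBot.bddBelow _) hk
      rw [← NNReal.coe_le_coe, coe_scaledDepth] at h1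
      exact (le_div_iff₀ hl).1 h1
  have hlow : ∀ᶠ n : ℕ in atTop,
      depthLaw a n (scaledDepth n ⁻¹' (F ∩ {x | (x : ℝ) ≤ a})) ≤
        ENNReal.ofReal ((n : ℝ) ^ (-c)) := by
    have hcl : IsClosed (F ∩ {x : ℝ≥0 | (x : ℝ) ≤ a}) :=
      hF.inter (isClosed_le NNReal.continuous_coe continuous_const)
    rcases (F ∩ {x : ℝ≥0 | (x : ℝ) ≤ a}).eq_empty_or_nonempty with he | hne
    · simp [he]
    · have hbdd : BddAbove (F ∩ {x : ℝ≥0 | (x : ℝ) ≤ a}) :=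
        ⟨a.toNNReal, fun x hx => NNReal.coe_le_coe.1 (by
          rw [Real.coe_toNNReal a ha.le]; exact hx.2)⟩
      have hmem := hcl.csSup_mem hne hbdd
      filter_upwards [eventually_tail_le ha (hc _ hmem.1), hlogpos] with n hn hl
      refine hn _ (Or.inr ⟨hmem.2, fun k hk => ?_⟩)
      have h1 : scaledDepth n k ≤ sSup (F ∩ {x : ℝ≥0 | (x : ℝ) ≤ a}) := le_csSup hbdd hk
      rw [← NNReal.coe_le_coe, coe_scaledDepth] at h1
      exact (div_le_iff₀ hl).1 h1
  filter_upwards [hup, hlow] with n h1 h2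
  rw [two_mul, ENNReal.ofReal_add (by positivity) (by positivity)]
  refine le_trans (le_trans (measure_mono ?_) (measure_union_le _ _)) (add_le_add h1 h2)
  intro k hk
  rcases le_total a (scaledDepth n k : ℝ) with h | h
  · exact Or.inl ⟨hk, h⟩
  · exact Or.inr ⟨hk, h⟩

lemma eventually_le_open (ha : 0 < a) {G : Set ℝ≥0} (hG : IsOpen G) {x : ℝ≥0} (hxG : x ∈ G)
    {c : ℝ} (hc : eta a x < c) :
    ∀ᶠ n : ℕ in atTop, ENNReal.ofReal (2⁻¹ * (n : ℝ) ^ (-c)) ≤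
      depthLaw a n (scaledDepth n ⁻¹' G) := by
  wlog hx : 0 < x generalizing x
  · have hU : ∀ᶠ y in 𝓝[>] x, (y ∈ G ∧ eta a y < c) ∧ y ∈ Set.Ioi x :=
      (((hG.eventually_mem hxG).and
        ((continuous_eta ha).continuousAt.eventually_lt_const hc)).filter_mono
          nhdsWithin_le_nhds).and self_mem_nhdsWithin
    obtain ⟨y, ⟨hy1, hy2⟩, hy⟩ := hU.exists
    exact this hy1 hy2 (lt_of_le_of_lt zero_le hy)
  have hx0 : (0 : ℝ) < x := hx
  rw [eta_eq] at hc
  obtain ⟨δ, hδ, hn⟩ := eventually_le_depthLaw ha hx0 (x := x) (e := -c) (by linarith)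
  obtain ⟨ε, hε, hball⟩ := Metric.isOpen_iff.1 hG x hxG
  have hr : 0 < min δ ε := lt_min hδ hε
  obtain ⟨c', hc', hconc⟩ := eventually_concentration hx0 hr
  have hlogpos : ∀ᶠ n : ℕ in atTop, 0 < Real.log n :=
    (Real.tendsto_log_atTop.comp tendsto_natCast_atTop_atTop).eventually_gt_atTop 0
  have hsmall : ∀ᶠ n : ℕ in atTop, (n : ℝ) ^ (-c') < 1 / 4 :=
    ((tendsto_rpow_neg_atTop hc').comp tendsto_natCast_atTop_atTop).eventually_lt_const
      (by norm_num)
  filter_upwards [hn, hconc, hlogpos, hsmall] with n h1 h2 h3 h4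
  have := isProbabilityMeasure_depthLaw hx0 n
  let S : Set ℕ := {k | min δ ε * Real.log n ≤ |(k : ℝ) - x * Real.log n|}
  have hS : depthLaw x n S ≤ ENNReal.ofReal 2⁻¹ := by
    refine h2.trans ?_
    rw [show (2 : ℝ≥0∞) = ENNReal.ofReal 2 by simp, ← ENNReal.ofReal_mul (by norm_num)]
    exact ENNReal.ofReal_le_ofReal (by linarith)
  have hSc : ENNReal.ofReal 2⁻¹ ≤ depthLaw x n Sᶜ := by
    rw [prob_compl_eq_one_sub MeasurableSet.of_discrete]
    refine le_trans ?_ (tsub_le_tsub_left hS 1)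
    rw [← ENNReal.ofReal_one, ← ENNReal.ofReal_sub _ (by norm_num)]
    exact ENNReal.ofReal_le_ofReal (by norm_num)
  have hlt : ∀ k ∈ Sᶜ, |(k : ℝ) - x * Real.log n| < min δ ε * Real.log n :=
    fun k hk => not_le.1 hk
  rw [mul_comm, ENNReal.ofReal_mul (by positivity)]
  refine (mul_le_mul_right hSc _).trans ((h1 Sᶜ fun k hk => ?_).trans (measure_mono ?_))
  · exact (hlt k hk).le.trans (mul_le_mul_of_nonneg_right (min_le_left _ _) h3.le)
  · intro k hk
    refine hball ?_
    rw [Metric.mem_ball, NNReal.dist_eq, coe_scaledDepth]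
    have h5 : (k : ℝ) / Real.log n - x = (k - x * Real.log n) / Real.log n := by field_simp
    rw [h5, abs_div, abs_of_pos h3, div_lt_iff₀ h3]
    exact (hlt k hk).trans_le (mul_le_mul_of_nonneg_right (min_le_right _ _) h3.le)

lemma tendsto_log_natCast : Tendsto (fun n : ℕ => Real.log n) atTop atTop :=
  Real.tendsto_log_atTop.comp tendsto_natCast_atTop_atTop

lemma tendsto_inv_log_mul_log {C : ℝ} (hC : 0 < C) (c : ℝ) :
    Tendsto (fun n : ℕ => (((Real.log n)⁻¹ : ℝ) : EReal) *
      ENNReal.log (ENNReal.ofReal (C * (n : ℝ) ^ (-c)))) atTop (𝓝 ((-c : ℝ) : EReal)) := by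
  have h : Tendsto (fun n : ℕ => Real.log C / Real.log n + -c) atTop (𝓝 (0 + -c)) :=
    (tendsto_const_nhds.div_atTop tendsto_log_natCast).add tendsto_const_nhds
  rw [zero_add] at h
  refine (EReal.tendsto_coe.2 h).congr' ?_
  filter_upwards [tendsto_log_natCast.eventually_gt_atTop 0, eventually_gt_atTop 0] with n h1 h2
  have hn : (0 : ℝ) < n := by exact_mod_cast h2
  have hp : 0 < (n : ℝ) ^ (-c) := Real.rpow_pos_of_pos hn _
  rw [ENNReal.log_ofReal_of_pos (by positivity), Real.log_mul hC.ne' hp.ne', Real.log_rpow hn,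
    ← EReal.coe_mul]
  congr 1
  field_simp

theorem largeDeviationPrinciple_depthLaw (ha : 0 < a) :
    LargeDeviationPrinciple (fun n => (depthLaw a n).map (scaledDepth n))
      (fun n : ℕ => Real.log n) (fun x : ℝ≥0 => ((eta a x : ℝ) : EReal)) where
  speed := tendsto_log_natCast
  rate_nonneg x := EReal.coe_nonneg.2 (eta_nonneg ha x)
  rate_lsc := (continuous_coe_real_ereal.comp (continuous_eta ha)).lowerSemicontinuous
  upper F hF := by
    rw [EReal.le_neg]
    refine EReal.ge_of_forall_gt_iff_ge.1 fun c hc => ?_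
    rw [EReal.le_neg, ← EReal.coe_neg, ← (tendsto_inv_log_mul_log two_pos c).limsup_eq]
    have hc' : ∀ x ∈ F, c < eta a x := fun x hx =>
      EReal.coe_lt_coe_iff.1 (hc.trans_le (iInf₂_le x hx))
    refine limsup_le_limsup ?_
    filter_upwards [eventually_closed_le ha hF hc'] with n hn
    rw [Measure.map_apply Measurable.of_discrete hF.measurableSet]
    exact mul_le_mul_of_nonneg_left (ENNReal.log_le_log hn)
      (EReal.coe_nonneg.2 (inv_nonneg.2 (Real.log_natCast_nonneg n)))
  lower G hG := by
    rw [EReal.neg_le]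
    refine EReal.le_of_forall_lt_iff_le.1 fun c hc => ?_
    rw [EReal.neg_le, ← EReal.coe_neg,
      ← (tendsto_inv_log_mul_log (C := 2⁻¹) (by norm_num) c).liminf_eq]
    obtain ⟨x, hx, hxc⟩ : ∃ x ∈ G, eta a x < c := by
      simpa only [iInf_lt_iff, EReal.coe_lt_coe_iff, exists_prop] using hc
    refine liminf_le_liminf ?_
    filter_upwards [eventually_le_open ha hG hx hxc] with n hn
    rw [Measure.map_apply Measurable.of_discrete hG.measurableSet]
    exact mul_le_mul_of_nonneg_left (ENNReal.log_le_log hn)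
      (EReal.coe_nonneg.2 (inv_nonneg.2 (Real.log_natCast_nonneg n)))

end LargeDeviations

section StrongLaw

variable {a : ℝ}

lemma tendsto_nat_log_two : Tendsto (Nat.log 2) atTop atTop :=
  tendsto_atTop.2 fun b => (eventually_ge_atTop (2 ^ b)).mono fun _ hn =>
    Nat.le_log_of_pow_le one_lt_two hn

/-- A monotone sequence that is asymptotic to `a * log n` along the powers of `2` is so along all
integers. -/
lemma tendsto_div_log_of_powers {f : ℕ → ℕ} (hf : Monotone f)
    (h : Tendsto (fun j : ℕ => (f (2 ^ j) : ℝ) / (j * Real.log 2)) atTop (𝓝 a)) :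
    Tendsto (fun n : ℕ => (f n : ℝ) / Real.log n) atTop (𝓝 a) := by
  have hl2 : 0 < Real.log 2 := Real.log_pos one_lt_two
  have hratio : Tendsto (fun j : ℕ => ((j + 1 : ℕ) : ℝ) / j) atTop (𝓝 1) := by
    have h1 : Tendsto (fun j : ℕ => 1 + 1 / (j : ℝ)) atTop (𝓝 (1 + 0)) :=
      tendsto_const_nhds.add tendsto_one_div_atTop_nhds_zero_nat
    rw [add_zero] at h1
    refine h1.congr' ?_
    filter_upwards [eventually_gt_atTop 0] with j hj
    have : (j : ℝ) ≠ 0 := by exact_mod_cast hj.ne'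
    push_cast
    field_simp
  have hup : Tendsto (fun j : ℕ => (f (2 ^ (j + 1)) : ℝ) / (j * Real.log 2)) atTop (𝓝 a) := by
    have h1 := (h.comp (tendsto_add_atTop_nat 1)).mul hratio
    rw [mul_one] at h1
    refine h1.congr' ?_
    filter_upwards [eventually_gt_atTop 0] with j hj
    have : (j : ℝ) ≠ 0 := by exact_mod_cast hj.ne'
    simp only [Function.comp]
    push_cast
    field_simp
  have hlow : Tendsto (fun j : ℕ => (f (2 ^ j) : ℝ) / ((j + 1 : ℕ) * Real.log 2)) atTop (𝓝 a) := by
    have h1 := h.div hratio one_ne_zero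
    rw [div_one] at h1
    refine h1.congr' ?_
    filter_upwards [eventually_gt_atTop 0] with j hj
    have : (j : ℝ) ≠ 0 := by exact_mod_cast hj.ne'
    simp only [Pi.div_apply]
    push_cast
    field_simp
  refine tendsto_of_tendsto_of_tendsto_of_le_of_le' (hlow.comp tendsto_nat_log_two)
    (hup.comp tendsto_nat_log_two) ?_ ?_
  all_goals
    filter_upwards [eventually_ge_atTop 2] with n hn
    have hn0 : n ≠ 0 := by omega
    have hj : 0 < Nat.log 2 n := Nat.log_pos one_lt_two hn
    have hj' : (0 : ℝ) < Nat.log 2 n := by exact_mod_cast hj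
    have h1 : 2 ^ Nat.log 2 n ≤ n := Nat.pow_log_le_self 2 hn0
    have h2 : n ≤ 2 ^ (Nat.log 2 n + 1) := (Nat.lt_pow_succ_log_self one_lt_two n).le
    have hn' : (0 : ℝ) < n := by positivity
    have h3 : (Nat.log 2 n : ℝ) * Real.log 2 ≤ Real.log n := by
      rw [← Real.log_pow]
      exact Real.log_le_log (by positivity) (by exact_mod_cast h1)
    have h4 : Real.log n ≤ ((Nat.log 2 n + 1 : ℕ) : ℝ) * Real.log 2 := by
      rw [← Real.log_pow]
      exact Real.log_le_log hn' (by exact_mod_cast h2)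
    have h5 : 0 < (Nat.log 2 n : ℝ) * Real.log 2 := by positivity
    simp only [Function.comp]
  · exact div_le_div₀ (by positivity) (by exact_mod_cast hf h1) (h5.trans_le h3) h4
  · exact div_le_div₀ (by positivity) (by exact_mod_cast hf h2) h5 h3

theorem ae_tendsto_depth_div_log {Q : Measure Path} (ha : 0 < a)
    (hlaw : ∀ n, Q.map (depth n) = depthLaw a n) (hmono : ∀ᵐ x ∂Q, Monotone fun n => depth n x) :
    ∀ᵐ x ∂Q, Tendsto (fun n : ℕ => (depth n x : ℝ) / Real.log n) atTop (𝓝 a) := by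
  have hl2 : 0 < Real.log 2 := Real.log_pos one_lt_two
  have key : ∀ m : ℕ, ∀ᵐ x ∂Q, ∀ᶠ j : ℕ in atTop,
      |(depth (2 ^ j) x : ℝ) - a * Real.log (2 ^ j : ℕ)| <
        1 / ((m : ℝ) + 1) * Real.log (2 ^ j : ℕ) := by
    intro m
    obtain ⟨c, hc, hconc⟩ := eventually_concentration ha (δ := 1 / ((m : ℝ) + 1)) (by positivity)
    have htwo : Tendsto (fun j : ℕ => 2 ^ j) atTop atTop :=
      tendsto_pow_atTop_atTop_of_one_lt one_lt_two
    obtain ⟨J, hJ⟩ := eventually_atTop.1 (htwo.eventually hconc)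
    let A : ℕ → Set ℕ := fun n =>
      {k | 1 / ((m : ℝ) + 1) * Real.log n ≤ |(k : ℝ) - a * Real.log n|}
    let s : ℕ → Set Path := fun j => if J ≤ j then depth (2 ^ j) ⁻¹' A (2 ^ j) else ∅
    have hr : (2 : ℝ) ^ (-c) < 1 := Real.rpow_lt_one_of_one_lt_of_neg one_lt_two (by linarith)
    have hbound : ∀ j, Q (s j) ≤ ENNReal.ofReal (2 * ((2 : ℝ) ^ (-c)) ^ j) := by
      intro j
      by_cases hj : J ≤ j
      · simp only [s, hj, if_true]
        rw [← Measure.map_apply (measurable_depth _) MeasurableSet.of_discrete, hlaw]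
        refine (hJ j hj).trans (le_of_eq ?_)
        rw [ENNReal.ofReal_mul (by norm_num)]
        congr 2
        · simp
        · push_cast
          rw [← Real.rpow_natCast, ← Real.rpow_natCast, ← Real.rpow_mul (by norm_num),
            ← Real.rpow_mul (by norm_num), mul_comm]
      · simp [s, hj]
    have hsum : ∑' j, Q (s j) ≠ ∞ := by
      refine ne_top_of_le_ne_top ?_ (ENNReal.tsum_le_tsum hbound)
      exact ((summable_geometric_of_lt_one (by positivity) hr).mul_left 2).tsum_ofReal_ne_top
    filter_upwards [ae_eventually_notMem hsum] with x hx
    filter_upwards [hx, eventually_ge_atTop J] with j h1 h2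
    simp only [s, h2, if_true] at h1
    exact not_le.1 h1
  filter_upwards [hmono, ae_all_iff.2 key] with x h1 h2
  refine tendsto_div_log_of_powers h1 (Metric.tendsto_nhds.2 fun ε hε => ?_)
  obtain ⟨m, hm⟩ := exists_nat_one_div_lt hε
  filter_upwards [h2 m, eventually_gt_atTop 0] with j h3 hj
  have hj' : (0 : ℝ) < j := by exact_mod_cast hj
  have hp : 0 < (j : ℝ) * Real.log 2 := by positivity
  rw [Nat.cast_pow, Nat.cast_ofNat, Real.log_pow] at h3
  rw [Real.dist_eq, div_sub' hp.ne', abs_div, abs_of_pos hp, div_lt_iff₀ hp, mul_comm _ a]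
  exact h3.trans (mul_lt_mul_of_pos_right hm hp)

end StrongLaw

section CentralLimit

variable {a : ℝ}

open Complex in
lemma integral_depthLaw_pow (ha : 0 < a) {w : ℂ} (hw : ‖w‖ ≤ 1) (n : ℕ) :
    ∫ k, w ^ k ∂(depthLaw a n) =
      ∏ k ∈ Finset.range n, (1 + ((a / (k + a) : ℝ) : ℂ) * (w - 1)) := by
  have hint : ∀ n, Integrable (fun k => w ^ k) (depthLaw a n) := fun n => by
    have := isProbabilityMeasure_depthLaw ha n
    refine Integrable.of_bound Measurable.of_discrete.aestronglyMeasurable 1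
      (ae_of_all _ fun k => ?_)
    rw [norm_pow]
    exact pow_le_one₀ (norm_nonneg _) hw
  induction n with
  | zero => simp [depthLaw]
  | succ n ih =>
    have hp : (n : ℝ) + a ≠ 0 := by positivity
    have h2 : Integrable (fun k => w ^ k) ((depthLaw a n).map (· + 1)) := by
      refine (integrable_map_measure Measurable.of_discrete.aestronglyMeasurable
        Measurable.of_discrete.aemeasurable).2 ?_
      simpa only [Function.comp_def, pow_succ] using (hint n).mul_const w
    rw [depthLaw, integral_add_measure ((hint n).smul_measure ENNReal.ofReal_ne_top)
      (h2.smul_measure ENNReal.ofReal_ne_top), integral_smul_measure, integral_smul_measure,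
      integral_map Measurable.of_discrete.aemeasurable
        Measurable.of_discrete.aestronglyMeasurable, Finset.prod_range_succ, ← ih,
      ENNReal.toReal_ofReal (by positivity), ENNReal.toReal_ofReal (by positivity)]
    simp only [pow_succ, integral_mul_const, real_smul]
    have e : (n : ℝ) / (n + a) = 1 - a / (n + a) := by field_simp; ring
    rw [e]
    push_cast
    ring

lemma norm_prod_sub_prod_le {u v : ℕ → ℂ} (hu : ∀ k, ‖u k‖ ≤ 1) (hv : ∀ k, ‖v k‖ ≤ 1) (n : ℕ) :
    ‖∏ k ∈ Finset.range n, u k - ∏ k ∈ Finset.range n, v k‖ ≤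
      ∑ k ∈ Finset.range n, ‖u k - v k‖ := by
  induction n with
  | zero => simp
  | succ n ih =>
    rw [Finset.prod_range_succ, Finset.prod_range_succ, Finset.sum_range_succ]
    have hV : ‖∏ k ∈ Finset.range n, v k‖ ≤ 1 := by
      rw [norm_prod]
      exact Finset.prod_le_one (fun _ _ => norm_nonneg _) fun k _ => hv k
    set U := ∏ k ∈ Finset.range n, u k
    set W := ∏ k ∈ Finset.range n, v k
    calc ‖U * u n - W * v n‖ = ‖(U - W) * u n + W * (u n - v n)‖ := by ring_nf
      _ ≤ ‖U - W‖ * ‖u n‖ + ‖W‖ * ‖u n - v n‖ := by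
          refine (norm_add_le _ _).trans ?_
          rw [norm_mul, norm_mul]
      _ ≤ ‖U - W‖ * 1 + 1 * ‖u n - v n‖ := by
          gcongr
          exact hu n
      _ ≤ _ := by linarith

lemma summable_one_div_add_sq (ha : 0 < a) : Summable fun k : ℕ => 1 / ((k : ℝ) + a) ^ 2 := by
  refine ((Real.summable_one_div_nat_add_rpow a 2).2 one_lt_two).congr fun k => ?_
  rw [abs_of_pos (by positivity), Real.rpow_two]

/-- `∑_{k < n} a / (k + a) - a * log n` converges. -/
lemma exists_tendsto_sum_sub_log (ha : 0 < a) : ∃ l : ℝ, Tendsto (fun n : ℕ =>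
    ∑ k ∈ Finset.range n, a / ((k : ℝ) + a) - a * Real.log n) atTop (𝓝 l) := by
  have hs : Summable fun k : ℕ => a / ((k : ℝ) + a) - a / ((k : ℝ) + 1) := by
    refine Summable.of_norm_bounded (g := fun k : ℕ =>
      a * |1 - a| * (1 / ((k : ℝ) + a) ^ 2 + 1 / ((k : ℝ) + 1) ^ 2))
      (((summable_one_div_add_sq ha).add (summable_one_div_add_sq one_pos)).mul_left _) fun k => ?_
    have h1 : (0 : ℝ) < k + a := by positivity
    have h2 : (0 : ℝ) < k + 1 := by positivity
    have e : a / ((k : ℝ) + a) - a / ((k : ℝ) + 1) =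
        a * (1 - a) * (1 / ((k : ℝ) + a) * (1 / ((k : ℝ) + 1))) := by field_simp; ring
    rw [e, Real.norm_eq_abs, abs_mul, abs_mul, abs_of_pos ha,
      abs_of_pos (by positivity : (0 : ℝ) < 1 / ((k : ℝ) + a) * (1 / ((k : ℝ) + 1)))]
    refine mul_le_mul_of_nonneg_left ?_ (by positivity)
    rw [← one_div_pow, ← one_div_pow]
    nlinarith [sq_nonneg (1 / ((k : ℝ) + a) - 1 / ((k : ℝ) + 1)), sq_nonneg (1 / ((k : ℝ) + a)),
      sq_nonneg (1 / ((k : ℝ) + 1))]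
  refine ⟨_, (hs.hasSum.tendsto_sum_nat.add (Real.tendsto_harmonic_sub_log.const_mul a)).congr
    fun n => ?_⟩
  rw [Finset.sum_sub_distrib, harmonic]
  push_cast
  simp only [div_eq_mul_inv, ← Finset.mul_sum]
  ring

open Complex in
/-- Convergence of the characteristic functions of the normalized depths. -/
lemma tendsto_charFun_depth (ha : 0 < a) (t : ℝ) :
    Tendsto (fun n : ℕ => cexp (-(((t / √(a * Real.log n)) * (a * Real.log n) : ℝ) * I)) *
      ∏ k ∈ Finset.range n, (1 + ((a / (k + a) : ℝ) : ℂ) *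
        (cexp ((t / √(a * Real.log n) : ℝ) * I) - 1))) atTop (𝓝 (cexp (-(t : ℂ) ^ 2 / 2))) := by
  let τ : ℕ → ℝ := fun n => t / √(a * Real.log n)
  let w : ℕ → ℂ := fun n => cexp ((τ n : ℂ) * I)
  let v : ℕ → ℝ := fun n => a * Real.log n
  let p : ℕ → ℝ := fun k => a / (k + a)
  have hv : Tendsto v atTop atTop := tendsto_log_natCast.const_mul_atTop ha
  have hτ : Tendsto τ atTop (𝓝 0) :=
    tendsto_const_nhds.div_atTop (Real.tendsto_sqrt_atTop.comp hv)
  have hτv : ∀ᶠ n in atTop, v n * τ n ^ 2 = t ^ 2 := by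
    filter_upwards [hv.eventually_gt_atTop 0] with n hn
    have hn' : 0 < a * Real.log n := hn
    simp only [τ, v]
    rw [div_pow, Real.sq_sqrt hn'.le, mul_div_cancel₀ _ hn'.ne']
  have hw1 : ∀ n, ‖w n‖ = 1 := fun n => norm_exp_ofReal_mul_I _
  have hp0 : ∀ k, 0 ≤ p k := fun k => by positivity
  have hp1 : ∀ k, p k ≤ 1 := fun k => by
    refine (div_le_one (by positivity)).2 ?_
    linarith [(Nat.cast_nonneg k : (0 : ℝ) ≤ k)]
  have hδ : Tendsto (fun n => w n - 1) atTop (𝓝 0) := by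
    have : Tendsto w atTop (𝓝 (cexp (((0 : ℝ) : ℂ) * I))) :=
      (by fun_prop : Continuous fun s : ℝ => cexp ((s : ℂ) * I)).continuousAt.tendsto.comp hτ
    simpa using this.sub_const 1
  -- the product is close to an exponential
  have hprod : Tendsto (fun n => ∏ k ∈ Finset.range n, (1 + (p k : ℂ) * (w n - 1)) -
      cexp ((∑ k ∈ Finset.range n, p k : ℝ) * (w n - 1))) atTop (𝓝 0) := by
    obtain ⟨B, hB⟩ : ∃ B, ∀ n, ∑ k ∈ Finset.range n, p k ^ 2 ≤ B := by
      refine ⟨∑' k, p k ^ 2, fun n => Summable.sum_le_tsum _ (fun k _ => sq_nonneg _) ?_⟩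
      refine ((summable_one_div_add_sq ha).mul_left (a ^ 2)).congr fun k => ?_
      simp only [p]
      rw [div_pow]
      ring
    have hlim : Tendsto (fun n => B * ‖w n - 1‖ ^ 2) atTop (𝓝 0) := by
      simpa using (hδ.norm.pow 2).const_mul B
    refine squeeze_zero_norm' ?_ hlim
    have hsmall : ∀ᶠ n in atTop, ‖w n - 1‖ < 1 := by
      have := hδ.norm
      rw [norm_zero] at this
      exact this.eventually_lt_const one_pos
    filter_upwards [hsmall] with n hn
    have hexp : cexp ((∑ k ∈ Finset.range n, p k : ℝ) * (w n - 1)) =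
        ∏ k ∈ Finset.range n, cexp ((p k : ℂ) * (w n - 1)) := by
      rw [← exp_sum]
      push_cast
      rw [Finset.sum_mul]
    rw [hexp]
    refine (norm_prod_sub_prod_le (fun k => ?_) (fun k => ?_) n).trans ?_
    · rw [show 1 + (p k : ℂ) * (w n - 1) = ((1 - p k : ℝ) : ℂ) + (p k : ℂ) * w n by
        push_cast; ring]
      refine (norm_add_le _ _).trans ?_
      rw [norm_mul, hw1, norm_real, norm_real, Real.norm_of_nonneg (hp0 k),
        Real.norm_of_nonneg (sub_nonneg.2 (hp1 k))]
      linarith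
    · rw [norm_exp, Real.exp_le_one_iff, re_ofReal_mul]
      refine mul_nonpos_of_nonneg_of_nonpos (hp0 k) ?_
      have := (re_le_norm (w n)).trans_eq (hw1 n)
      simpa using this
    · calc ∑ k ∈ Finset.range n, ‖1 + (p k : ℂ) * (w n - 1) - cexp ((p k : ℂ) * (w n - 1))‖
          ≤ ∑ k ∈ Finset.range n, p k ^ 2 * ‖w n - 1‖ ^ 2 := by
            refine Finset.sum_le_sum fun k _ => ?_
            have hnorm : ‖(p k : ℂ) * (w n - 1)‖ = p k * ‖w n - 1‖ := by
              rw [norm_mul, norm_real, Real.norm_of_nonneg (hp0 k)]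
            rw [norm_sub_rev, ← sub_sub, ← mul_pow, ← hnorm]
            refine norm_exp_sub_one_sub_id_le ?_
            rw [hnorm]
            exact mul_le_one₀ (hp1 k) (norm_nonneg _) hn.le
        _ = (∑ k ∈ Finset.range n, p k ^ 2) * ‖w n - 1‖ ^ 2 := (Finset.sum_mul _ _ _).symm
        _ ≤ B * ‖w n - 1‖ ^ 2 := by gcongr; exact hB n
  -- the second order expansion
  have hquad : Tendsto (fun n => (v n : ℂ) * (w n - 1 - τ n * I)) atTop (𝓝 (-(t : ℂ) ^ 2 / 2)) := by
    rw [tendsto_iff_norm_sub_tendsto_zero]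
    have hlim : Tendsto (fun n => t ^ 2 * |τ n|) atTop (𝓝 0) := by
      simpa using hτ.abs.const_mul (t ^ 2)
    refine squeeze_zero' (Eventually.of_forall fun _ => norm_nonneg _) ?_ hlim
    have hsmall : ∀ᶠ n in atTop, |τ n| < 1 := by
      have := hτ.abs
      rw [abs_zero] at this
      exact this.eventually_lt_const one_pos
    filter_upwards [hτv, hsmall, hv.eventually_gt_atTop 0] with n h1 h2 h3
    have h4 : (v n : ℂ) * (w n - 1 - τ n * I) - -(t : ℂ) ^ 2 / 2 =
        v n * (cexp (τ n * I) - ∑ m ∈ Finset.range 3, ((τ n : ℂ) * I) ^ m / m.factorial) := by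
      have h5 : (t : ℂ) ^ 2 = v n * τ n ^ 2 := by exact_mod_cast h1.symm
      simp only [Finset.sum_range_succ, Finset.sum_range_zero, Nat.factorial, mul_pow, I_sq, w]
      rw [h5]
      push_cast
      ring
    have hn : ‖(τ n : ℂ) * I‖ = |τ n| := by rw [norm_mul, norm_I, mul_one, norm_real]; rfl
    have h6 := exp_bound (x := (τ n : ℂ) * I) (hn.trans_le h2.le) (n := 3) (by norm_num)
    rw [hn] at h6
    rw [h4, norm_mul, norm_real, Real.norm_of_nonneg h3.le]
    calc v n * _ ≤ v n * (|τ n| ^ 3 * 1) := by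
          refine mul_le_mul_of_nonneg_left (h6.trans ?_) h3.le
          refine mul_le_mul_of_nonneg_left ?_ (by positivity)
          norm_num [Nat.factorial]
      _ = v n * |τ n| ^ 2 * |τ n| := by ring
      _ = t ^ 2 * |τ n| := by rw [sq_abs, h1]
  obtain ⟨l, hl⟩ := exists_tendsto_sum_sub_log ha
  have hexpo : Tendsto (fun n => cexp (((∑ k ∈ Finset.range n, p k - v n : ℝ) : ℂ) * (w n - 1) +
      (v n : ℂ) * (w n - 1 - τ n * I))) atTop (𝓝 (cexp (-(t : ℂ) ^ 2 / 2))) := by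
    have h1 := (((continuous_ofReal.tendsto l).comp hl).mul hδ).add hquad
    rw [mul_zero, zero_add] at h1
    exact (continuous_exp.tendsto _).comp h1
  have hsmall : Tendsto (fun n => cexp (-((τ n * v n : ℝ) * I)) *
      (∏ k ∈ Finset.range n, (1 + (p k : ℂ) * (w n - 1)) -
        cexp ((∑ k ∈ Finset.range n, p k : ℝ) * (w n - 1)))) atTop (𝓝 0) := by
    rw [tendsto_zero_iff_norm_tendsto_zero] at hprod ⊢
    refine hprod.congr fun n => ?_
    rw [norm_mul, ← neg_mul, ← ofReal_neg, norm_exp_ofReal_mul_I, one_mul]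
  have hsum := hsmall.add hexpo
  rw [zero_add] at hsum
  refine hsum.congr fun n => ?_
  rw [mul_sub, ← exp_add]
  have : -(((τ n * v n : ℝ) : ℂ) * I) + ((∑ k ∈ Finset.range n, p k : ℝ) : ℂ) * (w n - 1) =
      ((∑ k ∈ Finset.range n, p k - v n : ℝ) : ℂ) * (w n - 1) +
        (v n : ℂ) * (w n - 1 - τ n * I) := by
    push_cast
    ring
  rw [this, sub_add_cancel]

open Complex in
theorem tendstoInDistribution_depth {Q : Measure Path} [IsProbabilityMeasure Q] (ha : 0 < a)
    (hlaw : ∀ n, Q.map (depth n) = depthLaw a n) :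
    TendstoInDistribution
      (fun (n : ℕ) (x : Path) => ((depth n x : ℝ) - a * Real.log n) / √(a * Real.log n))
      atTop (id : ℝ → ℝ) (fun _ => Q) (gaussianReal 0 1) := by
  have hm : ∀ n : ℕ, Measurable fun x : Path =>
      ((depth n x : ℝ) - a * Real.log n) / √(a * Real.log n) := fun n =>
    (Measurable.of_discrete (f := fun k : ℕ =>
      ((k : ℝ) - a * Real.log n) / √(a * Real.log n))).comp (measurable_depth n)
  refine ⟨fun n => (hm n).aemeasurable, aemeasurable_id, ?_⟩
  refine ProbabilityMeasure.tendsto_iff_tendsto_charFun.2 fun t => ?_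
  simp only [ProbabilityMeasure.coe_mk, Measure.map_id]
  rw [charFun_gaussianReal]
  have e : cexp ((t : ℂ) * ((0 : ℝ) : ℂ) * I - (((1 : ℝ≥0) : ℝ) : ℂ) * (t : ℂ) ^ 2 / 2) =
      cexp (-(t : ℂ) ^ 2 / 2) := by
    congr 1
    push_cast
    ring
  rw [e]
  refine (tendsto_charFun_depth ha t).congr fun n => ?_
  have hphi : ∀ f : ℕ → ℂ, ∫ x, f (depth n x) ∂Q = ∫ k, f k ∂(depthLaw a n) := fun f => by
    rw [← hlaw n, integral_map (measurable_depth n).aemeasurable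
      Measurable.of_discrete.aestronglyMeasurable]
  rw [charFun_apply_real, integral_map (hm n).aemeasurable
    (by fun_prop : Continuous fun x : ℝ => cexp ((t : ℂ) * x * I)).aestronglyMeasurable,
    hphi fun k => cexp ((t : ℂ) *
      ((((k : ℝ) - a * Real.log n) / √(a * Real.log n) : ℝ) : ℂ) * I),
    ← integral_depthLaw_pow ha (norm_exp_ofReal_mul_I _).le, ← integral_const_mul]
  refine integral_congr_ae (ae_of_all _ fun k => ?_)
  simp only
  rw [← exp_nat_mul, ← exp_add]
  congr 1
  push_cast
  ring

end CentralLimit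

end BST

theorem proposition5p1 {Ω : Type*} [MeasurableSpace Ω] (P : Measure Ω) [IsProbabilityMeasure P]
    (T : ℕ → Ω → BST.BinTree) (V : Ω → ℝ)
    (hT : BST.IsBSTProcess P T)
    (hV : Measurable V) (hVunif : pdf.IsUniform V (Set.Icc 0 1) P volume)
    (hindep : IndepFun (fun ω n => T n ω) V P)
    (z : ℝ) (hz : 0 < z) :
    (∃! Q : ProbabilityMeasure BST.Path,
      BST.IsTiltedLaw z (BST.untiltedLaw P T V) (Q : Measure BST.Path)) ∧
    ∀ Q : ProbabilityMeasure BST.Path,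
      BST.IsTiltedLaw z (BST.untiltedLaw P T V) (Q : Measure BST.Path) →
      (∀ᵐ x ∂(Q : Measure BST.Path),
        Tendsto (fun n : ℕ => (BST.depth n x : ℝ) / Real.log n) atTop (𝓝 (2 * z))) ∧
      TendstoInDistribution
        (fun (n : ℕ) (x : BST.Path) =>
          ((BST.depth n x : ℝ) - 2 * z * Real.log n) / √(2 * z * Real.log n))
        atTop (id : ℝ → ℝ) (fun _ => (Q : Measure BST.Path)) (gaussianReal 0 1) ∧
      BST.LargeDeviationPrinciple
        (fun n : ℕ => (Q : Measure BST.Path).map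
          (fun x => (BST.depth n x : ℝ≥0) / (Real.log n).toNNReal))
        (fun n : ℕ => Real.log n)
        (fun x : ℝ≥0 => ((BST.eta (2 * z) x : ℝ) : EReal)) := by
  have hrec := BST.isRecordLaw_untiltedLaw hT hV hVunif hindep
  have hprob : IsProbabilityMeasure (BST.untiltedLaw P T V) :=
    Measure.isProbabilityMeasure_map (BST.measurable_markedPath hT hV).aemeasurable
  refine ⟨hrec.existsUnique_tiltedLaw hz, fun Q hQ => ?_⟩
  have ha : 0 < 2 * z := by positivity
  have hlaw := fun n => hQ.map_depth hz hrec n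
  refine ⟨BST.ae_tendsto_depth_div_log ha hlaw (hQ.ae_monotone_depth hrec),
    BST.tendstoInDistribution_depth ha hlaw, ?_⟩
  have hmap : ∀ n : ℕ, (Q : Measure BST.Path).map
      (fun x => (BST.depth n x : ℝ≥0) / (Real.log n).toNNReal) =
      (BST.depthLaw (2 * z) n).map (BST.scaledDepth n) := fun n => by
    rw [← hlaw n, Measure.map_map Measurable.of_discrete (BST.measurable_depth n)]
    rfl
  simp only [hmap]
  exact BST.largeDeviationPrinciple_depthLaw ha
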